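/- Let $\mathbb T^d=\mathbb R^d/\mathbb Z^d$ and, for $U\in C^2(\mathbb T^d)$ and $\kappa>0$, let $\mu=\mu_{U,\kappa}$ be the probability measure $\mu(dx)=Z^{-1}e^{-U(x)/\kappa}\,dx$ on $\mathbb T^d$, where $Z=\int_{\mathbb T^d}e^{-U/\kappa}\,dx$. Let $\dot H^1(\mu)$ be the space of real functions $f\in L^2(\mu)$ with $\int f\,d\mu=0$ and weak gradient $\nabla f\in L^2(\mu)$, and put $\|f\|_{\dot H^1(\mu)}=\|\nabla f\|_{L^2(\mu)}$. A $\mu$-preserving bijection $\Phi$ of $\mathbb T^d$ is called mixing with rate $h$ if $$\Big|\int_{\mathbb T^d} (f\circ\Phi^n)\, g\,d\mu\Big|\le h(n)\,\|f\|_{\dot H^1(\mu)}\|g\|_{\dot H^1(\mu)}\qquad\text{for all } f,g\in\dot H^1(\mu),\ n\ge 0 .$$ There are a constant $\gamma>0$, matrices $A_d\in SL(d,\mathbb Z)$ ($d\ge2$), and numbers $D=D(d,U,\kappa)$ such that the following holds. (0) For every $d\ge2$ the matrix $A_d$ is hyperbolic (it has no complex eigenvalue of modulus $1$) and block diagonal,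 with all diagonal blocks of size $2$ or $3$. (1) For all $d\ge2$, $U\in C^2(\mathbb T^d)$ and $\kappa>0$ we have $D(d,U,\kappa)>0$, and there are $C^2$ diffeomorphisms $\Phi,\psi$ of $\mathbb T^d$ such that $\psi$ pushes $\mu$ forward to Lebesgue measure, $\Phi=\psi^{-1}\circ\Psi\circ\psi$ with the toral automorphism $\Psi(x)=A_dx \pmod{\mathbb Z^d}$, $\Phi$ preserves $\mu$, and $\Phi$ is mixing with rate $h(n)=D(d,U,\kappa)\,e^{-\gamma n}$. (So $\gamma$ depends on none of $\kappa$, $d$, $U$.) (2) For every $\tilde U\in C^2(\mathbb T)$ there are constants $C$ and $\kappa_0>0$, independent of $d$, such that for all $d\ge 2$ and $0<\kappa<\kappa_0$, with $U(x)=\sum_{i=1}^d\tilde U(x_i)$, $$D(d,U,\kappa)\le\sqrt d\;e^{C/\kappa}.$$ -/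

import Mathlib

open MeasureTheory
open scoped ContDiff

noncomputable section

namespace TorusMixing

/-- The torus `𝕋ᵈ = ℝᵈ / ℤᵈ`. -/
abbrev T (d : ℕ) : Type := UnitAddTorus (Fin d)

/-- Lebesgue measure on `𝕋ᵈ`, of total mass one. -/
def leb (d : ℕ) : Measure (T d) := Measure.pi fun _ => AddCircle.haarAddCircle

/-- The covering projection `ℝᵈ → 𝕋ᵈ`. -/
def proj (d : ℕ) (x : Fin d → ℝ) : T d := fun i => (x i : UnitAddCircle)

/-- A real function on `𝕋ᵈ` is `Cⁿ` when the periodic function on `ℝᵈ` that it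
corresponds to is. -/
def FunContDiff {d : ℕ} (n : WithTop ℕ∞) (f : T d → ℝ) : Prop :=
  ContDiff ℝ n fun x : Fin d → ℝ => f (proj d x)

/-- A self-map of `𝕋ᵈ` is `Cⁿ` when it has a `Cⁿ` lift `ℝᵈ → ℝᵈ`. -/
def MapContDiff {d : ℕ} (n : WithTop ℕ∞) (Φ : T d → T d) : Prop :=
  ∃ F : (Fin d → ℝ) → (Fin d → ℝ), ContDiff ℝ n F ∧ ∀ x, Φ (proj d x) = proj d (F x)

/-- A bijection of `𝕋ᵈ` is a `Cⁿ` diffeomorphism when it and its inverse are `Cⁿ`. -/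
def IsDiffeo {d : ℕ} (n : WithTop ℕ∞) (Φ : T d ≃ T d) : Prop :=
  MapContDiff n Φ ∧ MapContDiff n Φ.symm

/-- The probability measure `μ(dx) = Z⁻¹ exp (-U(x)/κ) dx` on `𝕋ᵈ`,
where `Z = ∫ exp (-U/κ) dx`. -/
def gibbs {d : ℕ} (U : T d → ℝ) (κ : ℝ) : Measure (T d) :=
  (leb d).tilted fun x => -U x / κ

/-- The classical partial derivative `∂ᵢ φ` of a function on `𝕋ᵈ`. -/
def partialDeriv {d : ℕ} (i : Fin d) (φ : T d → ℝ) (x : T d) : ℝ :=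
  deriv (fun t : ℝ => φ (x + Pi.single i (t : UnitAddCircle))) 0

/-- `G` is the weak gradient of `f` on `𝕋ᵈ` (both are locally integrable where this is used). -/
def IsWeakGrad {d : ℕ} (f : T d → ℝ) (G : T d → EuclideanSpace ℝ (Fin d)) : Prop :=
  ∀ φ : T d → ℝ, FunContDiff ∞ φ → ∀ i : Fin d,
    ∫ x, f x * partialDeriv i φ x ∂(leb d) = -∫ x, G x i * φ x ∂(leb d)

/-- `f` lies in `Ḣ¹(μ)`, `μ = gibbs U κ`, with weak gradient `G`:
`f` and `∇f = G` are in `L²(μ)`, and `f` has `μ`-mean zero. -/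
structure InHDot1 {d : ℕ} (U : T d → ℝ) (κ : ℝ) (f : T d → ℝ)
    (G : T d → EuclideanSpace ℝ (Fin d)) : Prop where
  memLp : MemLp f 2 (gibbs U κ)
  memLp_grad : MemLp G 2 (gibbs U κ)
  weakGrad : IsWeakGrad f G
  mean_zero : ∫ x, f x ∂(gibbs U κ) = 0

/-- The seminorm `‖f‖_{Ḣ¹(μ)} = ‖∇f‖_{L²(μ)}` in terms of `G = ∇f`. -/
def hDot1Norm {d : ℕ} (U : T d → ℝ) (κ : ℝ) (G : T d → EuclideanSpace ℝ (Fin d)) : ℝ :=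
  Real.sqrt (∫ x, ‖G x‖ ^ 2 ∂(gibbs U κ))

/-- `Φ` is mixing with rate `h` for `μ = gibbs U κ`: for all `f, g ∈ Ḣ¹(μ)` and all `n`,
`|⟨f ∘ Φⁿ, g⟩_μ| ≤ h(n) ‖f‖_{Ḣ¹(μ)} ‖g‖_{Ḣ¹(μ)}`. -/
def MixesWithRate {d : ℕ} (U : T d → ℝ) (κ : ℝ) (Φ : T d → T d) (h : ℕ → ℝ) : Prop :=
  ∀ (f g : T d → ℝ) (Gf Gg : T d → EuclideanSpace ℝ (Fin d)),
    InHDot1 U κ f Gf → InHDot1 U κ g Gg → ∀ n : ℕ,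
      |∫ x, f (Φ^[n] x) * g x ∂(gibbs U κ)| ≤ h n * hDot1Norm U κ Gf * hDot1Norm U κ Gg

/-- The map `x ↦ A x mod ℤᵈ` of `𝕋ᵈ` given by an integer matrix. -/
def toralMap {d : ℕ} (A : Matrix (Fin d) (Fin d) ℤ) (x : T d) : T d :=
  fun i => ∑ j, A i j • x j

/-- No complex eigenvalue of `A` lies on the unit circle. -/
def IsHyperbolic {d : ℕ} (A : Matrix (Fin d) (Fin d) ℤ) : Prop :=
  ∀ z : ℂ, Module.End.HasEigenvalue (Matrix.toLin' (A.map (Int.cast : ℤ → ℂ))) z → ‖z‖ ≠ 1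

/-- `A` is block diagonal, with consecutive diagonal blocks that all have size two or three. -/
def IsBlockDiagonalTwoThree {d : ℕ} (A : Matrix (Fin d) (Fin d) ℤ) : Prop :=
  ∃ (m : ℕ) (s : Fin m → ℕ) (hs : ∑ i, s i = d)
    (B : ∀ i, Matrix (Fin (s i)) (Fin (s i)) ℤ),
    (∀ i, s i = 2 ∨ s i = 3) ∧
    A = Matrix.reindex (finSigmaFinEquiv.trans (finCongr hs))
      (finSigmaFinEquiv.trans (finCongr hs)) (Matrix.blockDiagonal' B)

/-- The separable potential `x ↦ ∑ᵢ V(xᵢ)` on `𝕋ᵈ`. -/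
def separable (d : ℕ) (V : UnitAddCircle → ℝ) (x : T d) : ℝ := ∑ i, V (x i)

end TorusMixing

end

/-!
Pulling back by a change of variables that carries `μ` to Lebesgue measure turns the problem into
the decay of correlations of a hyperbolic toral automorphism, and there Fourier series give it.

**Transport.** A positive `C²` density `ρ` on the torus is made uniform in its `i`-th coordinate by
a shear that moves only that coordinate, namely the normalized primitive of `ρ` along the `i`-th
axis; this transports `ρ` to its average over the `i`-th coordinate (`exists_shear`). One shear for
each coordinate leads to a constant density (`exists_isDiffeo_measurePreserving_smul`), so no
elliptic equation has to be solved, and no derivative is lost. For a separable potential the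
transport is a product of circle maps whose inverses have derivative at most `exp (2 sup|V| / κ)`
in every dimension (`exists_isDiffeo_measurePreserving_gibbs_separable`).

**Arithmetic.** The blocks of `A` are companion matrices of `X² - 3X + 1` and `X³ - X - 1`. The
transposed block is multiplication by a real root `α > 1` on `ℤ[α]`, and for `k ≠ 0` the norm of the
corresponding element of `ℤ[α]` is a nonzero integer, since the norm form is anisotropic modulo two.
Hence the component of `k` along the expanding direction is at least a multiple of `|k|⁻²`, which
gives `|k|² |Bⁿ k|² ≥ c αⁿ` for each block `B`, with an exponent and a constant that do not see how
many blocks there are (`Expands`, `exists_hyperbolic_matrix`).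

**Decay.** If `u` has Fourier coefficients `û`, then `u ∘ Ψⁿ` has coefficient `û(k)` at `Bⁿ k`, so
Parseval's identity and the Cauchy-Schwarz inequality bound the correlations by
`(c αⁿ)^(-1/2) ‖∇u‖ ‖∇v‖` (`norm_integral_conj_mul_comp_le`). The gradient of `f ∘ ψ⁻¹` is
controlled by that of `f` and the Jacobian of `ψ⁻¹`; for weakly differentiable `f` this follows by
approximation with partial Fourier sums (`sum_norm_fc_comp_le`), so that the mixing constant is proportional to a
squared Lipschitz bound of `ψ⁻¹` (`isMixingConstant_of_jacobianBound`). The numbers `D` are the best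
mixing constants plus one.
-/

noncomputable section

namespace TorusMixing

/-! ### Maps of the torus and their lifts -/

theorem isOpenQuotientMap_proj (d : ℕ) : IsOpenQuotientMap (proj d) :=
  IsOpenQuotientMap.piMap fun _ => QuotientAddGroup.isOpenQuotientMap_mk

theorem continuous_proj (d : ℕ) : Continuous (proj d) := (isOpenQuotientMap_proj d).continuous

theorem proj_surjective (d : ℕ) : Function.Surjective (proj d) :=
  (isOpenQuotientMap_proj d).surjective

theorem exists_mem_unitCube_proj_eq {d : ℕ} (x : T d) :
    ∃ y ∈ Set.Icc (0 : Fin d → ℝ) 1, proj d y = x := by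
  have h : ∀ i, ∃ y : ℝ, 0 ≤ y ∧ y ≤ 1 ∧ (y : UnitAddCircle) = x i := fun i => by
    obtain ⟨y, hy, hyx⟩ := AddCircle.coe_image_Icc_eq (1 : ℝ) 0 ▸ Set.mem_univ (x i)
    exact ⟨y, hy.1, by simpa using hy.2, hyx⟩
  choose y h0 h1 hy using h
  exact ⟨y, ⟨h0, h1⟩, funext hy⟩

theorem proj_eq_proj_iff {d : ℕ} {x y : Fin d → ℝ} :
    proj d x = proj d y ↔ ∃ k : Fin d → ℤ, x = y + fun i => (k i : ℝ) := by
  constructor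
  · intro h
    have h' : ∀ i, ∃ k : ℤ, x i = y i + k := fun i => by
      have := congrFun h i
      simp only [proj] at this
      rw [← sub_eq_zero, ← AddCircle.coe_sub, AddCircle.coe_eq_zero_iff] at this
      obtain ⟨k, hk⟩ := this
      exact ⟨k, by rw [zsmul_one] at hk; linarith⟩
    choose k hk using h'
    exact ⟨k, funext hk⟩
  · rintro ⟨k, rfl⟩
    funext i
    simp [proj]

theorem continuous_of_lift {d : ℕ} {X : Type*} [TopologicalSpace X] {f : T d → X}
    (h : Continuous fun x => f (proj d x)) : Continuous f :=
  (isOpenQuotientMap_proj d).isQuotientMap.continuous_iff.2 h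

theorem FunContDiff.continuous {d : ℕ} {n : WithTop ℕ∞} {f : T d → ℝ} (h : FunContDiff n f) :
    Continuous f :=
  continuous_of_lift (ContDiff.continuous h)

theorem MapContDiff.continuous {d : ℕ} {n : WithTop ℕ∞} {Φ : T d → T d} (h : MapContDiff n Φ) :
    Continuous Φ := by
  obtain ⟨F, hF, hΦ⟩ := h
  refine continuous_of_lift ?_
  simp_rw [hΦ]
  exact (continuous_proj d).comp hF.continuous

theorem MapContDiff.comp {d : ℕ} {n : WithTop ℕ∞} {Φ Ψ : T d → T d} (h : MapContDiff n Φ)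
    (h' : MapContDiff n Ψ) : MapContDiff n (Φ ∘ Ψ) := by
  obtain ⟨F, hF, hΦ⟩ := h
  obtain ⟨G, hG, hΨ⟩ := h'
  exact ⟨F ∘ G, hF.comp hG, fun x => by simp [hΦ, hΨ]⟩

theorem IsDiffeo.trans {d : ℕ} {n : WithTop ℕ∞} {Φ Ψ : T d ≃ T d} (h : IsDiffeo n Φ)
    (h' : IsDiffeo n Ψ) : IsDiffeo n (Φ.trans Ψ) :=
  ⟨h'.1.comp h.1, h.2.comp h'.2⟩

theorem IsDiffeo.symm {d : ℕ} {n : WithTop ℕ∞} {Φ : T d ≃ T d} (h : IsDiffeo n Φ) :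
    IsDiffeo n Φ.symm := ⟨h.2, h.1⟩

theorem IsDiffeo.refl {d : ℕ} (n : WithTop ℕ∞) : IsDiffeo n (Equiv.refl (T d)) :=
  ⟨⟨id, contDiff_id, fun _ => rfl⟩, ⟨id, contDiff_id, fun _ => rfl⟩⟩

/-- A bijection of `ℝᵈ` commuting with integer translations descends to the torus. -/
theorem exists_equiv_of_lift {d : ℕ} (F : (Fin d → ℝ) ≃ (Fin d → ℝ))
    (hF : ∀ x (k : Fin d → ℤ), F (x + fun i => (k i : ℝ)) = F x + fun i => (k i : ℝ)) :
    ∃ ψ : T d ≃ T d, (∀ x, ψ (proj d x) = proj d (F x)) ∧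
      ∀ x, ψ.symm (proj d x) = proj d (F.symm x) := by
  have hF' : ∀ x (k : Fin d → ℤ),
      F.symm (x + fun i => (k i : ℝ)) = F.symm x + fun i => (k i : ℝ) := fun x k => by
    rw [Equiv.symm_apply_eq, hF, Equiv.apply_symm_apply]
  have key : ∀ (G : (Fin d → ℝ) → (Fin d → ℝ)),
      (∀ x (k : Fin d → ℤ), G (x + fun i => (k i : ℝ)) = G x + fun i => (k i : ℝ)) →
      ∀ x, proj d (G (Function.surjInv (proj_surjective d) (proj d x))) = proj d (G x) := by
    intro G hG x
    obtain ⟨k, hk⟩ := proj_eq_proj_iff.1 (Function.surjInv_eq (proj_surjective d) (proj d x))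
    rw [hk, hG]
    exact proj_eq_proj_iff.2 ⟨k, rfl⟩
  refine ⟨⟨fun x => proj d (F (Function.surjInv (proj_surjective d) x)),
    fun x => proj d (F.symm (Function.surjInv (proj_surjective d) x)), fun x => ?_, fun x => ?_⟩,
    key F hF, key F.symm hF'⟩
  · obtain ⟨x, rfl⟩ := proj_surjective d x
    simp only [key F hF, key F.symm hF', Equiv.symm_apply_apply]
  · obtain ⟨x, rfl⟩ := proj_surjective d x
    simp only [key F hF, key F.symm hF', Equiv.apply_symm_apply]

instance (d : ℕ) : IsProbabilityMeasure (leb d) := by unfold leb; infer_instance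

/-! ### Rearrangement on the circle -/

section Rearrangement

/-- The normalized primitive `t ↦ ∫₀ᵗ q / ∫₀¹ q` of a positive periodic density `q`. It commutes
with integer translations and transports `q dt / ∫₀¹ q` to `dt` on the circle. -/
def rearr (q : ℝ → ℝ) (t : ℝ) : ℝ := (∫ s in (0 : ℝ)..t, q s) / ∫ s in (0 : ℝ)..1, q s

variable {q : ℝ → ℝ}

theorem integral_unit_pos (hq : Continuous q) (hpos : ∀ t, 0 < q t) :
    0 < ∫ s in (0 : ℝ)..1, q s :=
  intervalIntegral.intervalIntegral_pos_of_pos (hq.intervalIntegrable _ _) hpos one_pos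

theorem hasDerivAt_rearr (hq : Continuous q) (t : ℝ) :
    HasDerivAt (rearr q) (q t / ∫ s in (0 : ℝ)..1, q s) t :=
  (intervalIntegral.integral_hasDerivAt_right (hq.intervalIntegrable _ _)
    (hq.stronglyMeasurableAtFilter _ _) hq.continuousAt).div_const _

theorem continuous_rearr (hq : Continuous q) : Continuous (rearr q) :=
  continuous_iff_continuousAt.2 fun t => (hasDerivAt_rearr hq t).continuousAt

theorem strictMono_rearr (hq : Continuous q) (hpos : ∀ t, 0 < q t) : StrictMono (rearr q) :=
  strictMono_of_deriv_pos fun t => by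
    rw [(hasDerivAt_rearr hq t).deriv]
    exact div_pos (hpos t) (integral_unit_pos hq hpos)

theorem rearr_zero : rearr q 0 = 0 := by simp [rearr]

theorem rearr_one (hq : Continuous q) (hpos : ∀ t, 0 < q t) : rearr q 1 = 1 :=
  div_self (integral_unit_pos hq hpos).ne'

theorem rearr_add_int (hq : Continuous q) (hpos : ∀ t, 0 < q t) (hper : Function.Periodic q 1)
    (t : ℝ) (k : ℤ) : rearr q (t + k) = rearr q t + k := by
  have h1 : ∫ s in t..(t + k), q s = k * ∫ s in (0 : ℝ)..1, q s := by
    have := hper.intervalIntegral_add_zsmul_eq k t (fun _ _ => hq.intervalIntegrable _ _)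
    simpa [hper.intervalIntegral_add_eq t 0] using this
  have h2 := (intervalIntegral.integral_add_adjacent_intervals (μ := volume)
    (hq.intervalIntegrable 0 t) (hq.intervalIntegrable t (t + k)))
  have h0 := (integral_unit_pos hq hpos).ne'
  rw [rearr, rearr, ← h2, h1]
  field_simp

theorem rearr_int (hq : Continuous q) (hpos : ∀ t, 0 < q t) (hper : Function.Periodic q 1)
    (k : ℤ) : rearr q k = k := by
  simpa [rearr_zero] using rearr_add_int hq hpos hper 0 k

theorem bijective_rearr (hq : Continuous q) (hpos : ∀ t, 0 < q t) (hper : Function.Periodic q 1) :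
    Function.Bijective (rearr q) := by
  refine ⟨(strictMono_rearr hq hpos).injective, fun y => ?_⟩
  refine mem_range_of_exists_le_of_exists_ge (continuous_rearr hq) ⟨(⌊y⌋ : ℤ), ?_⟩
    ⟨(⌈y⌉ : ℤ), ?_⟩
  · rw [rearr_int hq hpos hper]; exact Int.floor_le y
  · rw [rearr_int hq hpos hper]; exact Int.le_ceil y

theorem measurePreserving_coe_haar :
    MeasurePreserving ((↑) : ℝ → UnitAddCircle) (volume.restrict (Set.Ioc 0 1))
      AddCircle.haarAddCircle := by
  have h := UnitAddCircle.measurePreserving_mk 0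
  rw [AddCircle.volume_eq_smul_haarAddCircle] at h
  simpa using h

theorem lintegral_haar (φ : UnitAddCircle → ENNReal) (hφ : Measurable φ) :
    ∫⁻ t, φ t ∂AddCircle.haarAddCircle = ∫⁻ t in Set.Ioc (0 : ℝ) 1, φ (t : UnitAddCircle) :=
  (measurePreserving_coe_haar.lintegral_comp hφ).symm

/-- Change of variables for `rearr` on the circle, for a circle map `e` lifted by `rearr q`. -/
theorem lintegral_comp_rearr {r : UnitAddCircle → ℝ} (hr : Continuous r) (hpos : ∀ t, 0 < r t)
    {e : UnitAddCircle → UnitAddCircle}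
    (he : ∀ t : ℝ, e t = (rearr (fun s : ℝ => r s) t : ℝ))
    {φ : UnitAddCircle → ENNReal} (hφ : Measurable φ) :
    ∫⁻ t, φ (e t) * ENNReal.ofReal (r t) ∂AddCircle.haarAddCircle =
      ENNReal.ofReal (∫ s in (0 : ℝ)..1, r s) * ∫⁻ t, φ t ∂AddCircle.haarAddCircle := by
  set q : ℝ → ℝ := fun s => r s with hq'
  have hq : Continuous q := hr.comp (AddCircle.continuous_mk' 1)
  have hqpos : ∀ t, 0 < q t := fun t => hpos _
  have hmono := strictMono_rearr hq hqpos
  have hQ := integral_unit_pos hq hqpos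
  have hec : Continuous e := by
    refine (QuotientAddGroup.isQuotientMap_mk _).continuous_iff.2 ?_
    have : Continuous fun t : ℝ => ((rearr q t : ℝ) : UnitAddCircle) :=
      (AddCircle.continuous_mk' 1).comp (continuous_rearr hq)
    exact this.congr fun t => (he t).symm
  rw [lintegral_haar _ (by fun_prop), lintegral_haar _ hφ]
  have himg : rearr q '' Set.Ioc 0 1 = Set.Ioc 0 1 := by
    ext y
    constructor
    · rintro ⟨t, ht, rfl⟩
      rw [← rearr_zero (q := q), ← rearr_one hq hqpos]
      exact ⟨hmono ht.1, hmono.monotone ht.2⟩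
    · intro hy
      have := intermediate_value_Ioc (zero_le_one) (continuous_rearr hq).continuousOn
      rw [rearr_zero, rearr_one hq hqpos] at this
      exact this hy
  have hcv := lintegral_image_eq_lintegral_deriv_mul_of_monotoneOn
    (measurableSet_Ioc (a := (0 : ℝ)) (b := 1))
    (fun t _ => (hasDerivAt_rearr hq t).hasDerivWithinAt) (hmono.monotone.monotoneOn _)
    (fun t => φ (t : UnitAddCircle))
  rw [himg] at hcv
  rw [hcv, ← lintegral_const_mul _ (by
    have := continuous_rearr hq
    fun_prop)]
  refine lintegral_congr fun t => ?_
  rw [he, ← mul_assoc, ← ENNReal.ofReal_mul hQ.le, mul_div_cancel₀ _ hQ.ne', mul_comm]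

/-! ### Smoothness of integrals with parameters -/

theorem contDiff_intervalIntegral {E F : Type} [NormedAddCommGroup E] [NormedSpace ℝ E]
    [ProperSpace E] [NormedAddCommGroup F] [NormedSpace ℝ F] [CompleteSpace F] (n : ℕ)
    {h : E × ℝ → F} (hh : ContDiff ℝ n h) : ContDiff ℝ n fun x => ∫ s in (0 : ℝ)..1, h (x, s) := by
  induction n generalizing F with
  | zero =>
    rw [Nat.cast_zero, contDiff_zero] at *
    exact intervalIntegral.continuous_parametric_intervalIntegral_of_continuous' (by fun_prop) _ _
  | succ n ih =>
    have hfd : ContDiff ℝ n fun p => (fderiv ℝ h p).comp (ContinuousLinearMap.inl ℝ E ℝ) :=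
      (hh.fderiv_right (by norm_cast)).clm_comp contDiff_const
    have hd : ∀ x s, HasFDerivAt (𝕜 := ℝ) (fun x => h (x, s))
        ((fderiv ℝ h (x, s)).comp (ContinuousLinearMap.inl ℝ E ℝ)) x := fun x s =>
      ((hh.differentiable (by norm_cast)).differentiableAt (x := (x, s))).hasFDerivAt.comp x
        (hasFDerivAt_prodMk_left (𝕜 := ℝ) x s)
    rw [Nat.cast_succ, contDiff_succ_iff_hasFDerivAt]
    refine ⟨_, ih hfd, fun x => ?_⟩
    obtain ⟨C, hC⟩ := ((isCompact_closedBall x 1).prod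
      (isCompact_Icc (a := (0 : ℝ)) (b := 1))).exists_bound_of_continuousOn
        hfd.continuous.continuousOn
    have hcont := hh.continuous
    have hcont' := hfd.continuous
    refine (intervalIntegral.hasFDerivAt_integral_of_dominated_of_fderiv_le (𝕜 := ℝ)
      (F := fun y s => h (y, s)) (F' := fun y s => (fderiv ℝ h (y, s)).comp
        (ContinuousLinearMap.inl ℝ E ℝ)) (bound := fun _ => C)
      (Metric.ball_mem_nhds x one_pos) ?_ ?_ ?_ ?_ ?_ ?_)
    · exact Filter.Eventually.of_forall fun y =>
        Continuous.aestronglyMeasurable (by fun_prop)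
    · exact Continuous.intervalIntegrable (by fun_prop) _ _
    · exact Continuous.aestronglyMeasurable (hcont'.comp (by fun_prop))
    · refine Filter.Eventually.of_forall fun s hs y hy =>
        hC (y, s) ⟨Metric.ball_subset_closedBall hy, ?_⟩
      rw [Set.uIoc_of_le zero_le_one] at hs
      exact ⟨hs.1.le, hs.2⟩
    · exact intervalIntegrable_const
    · exact Filter.Eventually.of_forall fun s _ y _ => hd y s

end Rearrangement

/-! ### One-coordinate shears -/

section Shear

/-- The inverse of a `Cⁿ` bijection with everywhere injective derivative is `Cⁿ`. -/
theorem contDiff_symm_of_injective_fderiv {E : Type*} [NormedAddCommGroup E] [NormedSpace ℝ E]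
    [FiniteDimensional ℝ E] {n : WithTop ℕ∞} (hn : n ≠ 0) (e : E ≃ E) (he : ContDiff ℝ n e)
    (hinj : ∀ x, Function.Injective (fderiv ℝ e x)) : ContDiff ℝ n e.symm := by
  have := FiniteDimensional.complete ℝ E
  set f' : E → (E ≃L[ℝ] E) := fun x =>
    (LinearEquiv.ofInjectiveEndo (fderiv ℝ e x : E →ₗ[ℝ] E) (hinj x)).toContinuousLinearEquiv
  have hf' : ∀ x, (f' x : E →L[ℝ] E) = fderiv ℝ e x := fun x => by ext v; rfl
  have hopen : IsOpenMap e := isOpenMap_of_hasStrictFDerivAt_equiv (f' := f') fun x => by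
    rw [hf']; exact he.contDiffAt.hasStrictFDerivAt hn
  refine (e.toHomeomorphOfContinuousOpen he.continuous hopen).contDiff_symm (f₀' := f')
    (fun x => ?_) he
  rw [hf']
  exact (he.differentiable hn).differentiableAt.hasFDerivAt

variable {d : ℕ}

theorem proj_update (x : Fin d → ℝ) (i : Fin d) (t : ℝ) :
    proj d (Function.update x i t) = Function.update (proj d x) i (t : UnitAddCircle) := by
  funext j
  rcases eq_or_ne j i with rfl | h
  · simp [proj]
  · simp [proj, h]

/-- The average of `ρ` over the `i`-th coordinate. -/
def coordAvg (i : Fin d) (ρ : T d → ℝ) (x : T d) : ℝ :=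
  ∫ s in (0 : ℝ)..1, ρ (Function.update x i (s : UnitAddCircle))

theorem coordAvg_update (i : Fin d) (ρ : T d → ℝ) (x : T d) (t : UnitAddCircle) :
    coordAvg i ρ (Function.update x i t) = coordAvg i ρ x := by
  simp [coordAvg]

variable {ρ : T d → ℝ}

theorem continuous_fiber (hρ : Continuous ρ) (x : T d) (i : Fin d) :
    Continuous fun t : UnitAddCircle => ρ (Function.update x i t) :=
  hρ.comp (continuous_const.update i continuous_id)

theorem continuous_fiber_coe (hρ : Continuous ρ) (x : T d) (i : Fin d) :
    Continuous fun t : ℝ => ρ (Function.update x i (t : UnitAddCircle)) :=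
  (continuous_fiber hρ x i).comp (AddCircle.continuous_mk' 1)

theorem periodic_fiber (x : T d) (i : Fin d) :
    Function.Periodic (fun t : ℝ => ρ (Function.update x i (t : UnitAddCircle))) 1 := fun t => by
  simp

theorem coordAvg_pos (hρ : Continuous ρ) (hpos : ∀ x, 0 < ρ x) (i : Fin d) (x : T d) :
    0 < coordAvg i ρ x :=
  integral_unit_pos (continuous_fiber_coe hρ x i) fun _ => hpos _

theorem FunContDiff.coordAvg {n : ℕ} (hρ : FunContDiff n ρ) (i : Fin d) :
    FunContDiff n (coordAvg i ρ) := by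
  unfold FunContDiff TorusMixing.coordAvg
  simp_rw [← proj_update]
  refine contDiff_intervalIntegral n
    (h := fun p : (Fin d → ℝ) × ℝ => ρ (proj d (Function.update p.1 i p.2))) ?_
  refine ContDiff.comp (g := fun x => ρ (proj d x)) hρ (contDiff_pi.2 fun j => ?_)
  rcases eq_or_ne j i with rfl | h
  · simpa using contDiff_snd
  · simp only [Function.update_of_ne h]; fun_prop

/-- The `i`-th coordinate of the lift of the shear along the `i`-th axis that makes the density `ρ`
uniform along that axis. -/
def shearCoord (i : Fin d) (ρ : T d → ℝ) (x : Fin d → ℝ) : ℝ :=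
  rearr (fun t : ℝ => ρ (Function.update (proj d x) i (t : UnitAddCircle))) (x i)

theorem shearCoord_update (i : Fin d) (ρ : T d → ℝ) (x : Fin d → ℝ) (t : ℝ) :
    shearCoord i ρ (Function.update x i t) =
      rearr (fun t : ℝ => ρ (Function.update (proj d x) i (t : UnitAddCircle))) t := by
  simp [shearCoord, proj_update]

theorem contDiff_shearCoord {n : ℕ} (hρ : FunContDiff n ρ) (hpos : ∀ x, 0 < ρ x) (i : Fin d) :
    ContDiff ℝ n (shearCoord i ρ) := by
  have h : shearCoord i ρ = fun x =>
      (x i * ∫ s in (0 : ℝ)..1, ρ (proj d (Function.update x i (x i * s)))) /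
        coordAvg i ρ (proj d x) := by
    funext x
    have := intervalIntegral.smul_integral_comp_mul_left (a := 0) (b := 1)
      (fun s => ρ (proj d (Function.update x i s))) (x i)
    rw [mul_zero, mul_one, smul_eq_mul] at this
    rw [this]
    simp_rw [proj_update]
    rfl
  rw [h]
  refine ContDiff.div (ContDiff.mul (contDiff_apply ℝ ℝ i) (contDiff_intervalIntegral n
    (h := fun p : (Fin d → ℝ) × ℝ => ρ (proj d (Function.update p.1 i (p.1 i * p.2)))) ?_))
    (hρ.coordAvg i) fun x => (coordAvg_pos hρ.continuous hpos i _).ne'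
  refine ContDiff.comp (g := fun x => ρ (proj d x)) hρ (contDiff_pi.2 fun j => ?_)
  rcases eq_or_ne j i with rfl | h
  · simp only [Function.update_self]; fun_prop
  · simp only [Function.update_of_ne h]; fun_prop

theorem bijective_update_shearCoord (hρ : Continuous ρ) (hpos : ∀ x, 0 < ρ x) (i : Fin d) :
    Function.Bijective fun x => Function.update x i (shearCoord i ρ x) := by
  have hb : ∀ x : Fin d → ℝ, Function.Bijective
      (rearr fun t : ℝ => ρ (Function.update (proj d x) i (t : UnitAddCircle))) := fun x =>
    bijective_rearr (continuous_fiber_coe hρ _ i) (fun _ => hpos _) (periodic_fiber _ i)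
  constructor
  · intro x y hxy
    have hne : y = Function.update x i (y i) := by
      funext j
      rcases eq_or_ne j i with rfl | h
      · simp
      · simpa [h] using (congrFun hxy j).symm
    have hi := congrFun hxy i
    simp only [Function.update_self] at hi
    rw [hne, shearCoord_update] at hi
    rw [hne, ← (hb x).1 hi, Function.update_eq_self]
  · intro y
    obtain ⟨t, ht⟩ := (hb y).2 (y i)
    refine ⟨Function.update y i t, ?_⟩
    simp only [shearCoord_update, ht]
    simp

theorem injective_fderiv_update_shearCoord {n : ℕ} (hn : n ≠ 0) (hρ : FunContDiff n ρ)
    (hpos : ∀ x, 0 < ρ x) (i : Fin d) (x : Fin d → ℝ) :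
    Function.Injective (fderiv ℝ (fun x => Function.update x i (shearCoord i ρ x)) x) := by
  have hn' : ((n : ℕ) : WithTop ℕ∞) ≠ 0 := by exact_mod_cast hn
  have hg := ((contDiff_shearCoord hρ hpos i).differentiable hn').differentiableAt.hasFDerivAt
    (x := x)
  set g' := fderiv ℝ (shearCoord i ρ) x
  have hF : HasFDerivAt (fun x => Function.update x i (shearCoord i ρ x))
      (ContinuousLinearMap.pi fun j =>
        if j = i then g' else ContinuousLinearMap.proj (R := ℝ) (φ := fun _ : Fin d => ℝ) j) x := by
    refine hasFDerivAt_pi.2 fun j => ?_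
    rcases eq_or_ne j i with rfl | h
    · simpa using hg
    · simp only [Function.update_of_ne h, if_neg h]
      exact hasFDerivAt_apply j x
  rw [hF.fderiv, injective_iff_map_eq_zero]
  intro v hv
  have hv' : v = v i • Pi.single i (1 : ℝ) := by
    funext j
    rcases eq_or_ne j i with rfl | h
    · simp
    · simpa [h] using congrFun hv j
  have hi : g' v = 0 := by simpa using congrFun hv i
  have hgi : 0 < g' (Pi.single i 1) := by
    have h1 : HasDerivAt (fun t => shearCoord i ρ (Function.update x i t)) (g' (Pi.single i 1))
        (x i) := by
      refine HasFDerivAt.comp_hasDerivAt (l := shearCoord i ρ) (l' := g') (x i) ?_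
        (hasDerivAt_update x i (x i))
      simpa using hg
    simp_rw [shearCoord_update] at h1
    have hc := continuous_fiber_coe hρ.continuous (proj d x) i
    rw [h1.unique (hasDerivAt_rearr hc (x i))]
    exact div_pos (hpos _) (integral_unit_pos hc fun _ => hpos _)
  rw [hv', map_smul, smul_eq_mul, mul_eq_zero] at hi
  rw [hv', hi.resolve_right hgi.ne', zero_smul]

/-- The density `ρ` is transported to its average over the `i`-th coordinate by a diffeomorphism
that moves the `i`-th coordinate only. -/
theorem exists_shear {n : ℕ} (hn : n ≠ 0) (hρ : FunContDiff n ρ) (hpos : ∀ x, 0 < ρ x)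
    (i : Fin d) :
    ∃ ψ : T d ≃ T d, IsDiffeo n ψ ∧
      MeasurePreserving ψ ((leb d).withDensity fun x => ENNReal.ofReal (ρ x))
        ((leb d).withDensity fun x => ENNReal.ofReal (coordAvg i ρ x)) := by
  have hn' : ((n : ℕ) : WithTop ℕ∞) ≠ 0 := by exact_mod_cast hn
  have hc := hρ.continuous
  set Θ : (Fin d → ℝ) ≃ (Fin d → ℝ) := Equiv.ofBijective _ (bijective_update_shearCoord hc hpos i)
  have hΘ : ∀ x, Θ x = Function.update x i (shearCoord i ρ x) := fun x => rfl
  have hΘc : ContDiff ℝ n Θ := by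
    refine contDiff_pi.2 fun j => ?_
    rcases eq_or_ne j i with rfl | h
    · simpa [hΘ] using contDiff_shearCoord hρ hpos j
    · simpa [hΘ, h] using contDiff_apply ℝ ℝ j
  obtain ⟨ψ, hψ, hψ'⟩ := exists_equiv_of_lift Θ fun x k => by
    have hp : proj d (x + fun i => (k i : ℝ)) = proj d x := proj_eq_proj_iff.2 ⟨k, rfl⟩
    funext j
    rcases eq_or_ne j i with rfl | h
    · simp only [hΘ, Function.update_self, Pi.add_apply, shearCoord, hp]
      exact rearr_add_int (continuous_fiber_coe hc _ j) (fun _ => hpos _) (periodic_fiber _ j) _ _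
    · simp [hΘ, h]
  have hdiff : IsDiffeo n ψ := ⟨⟨Θ, hΘc, hψ⟩, ⟨Θ.symm,
    contDiff_symm_of_injective_fderiv hn' Θ hΘc
      (injective_fderiv_update_shearCoord hn hρ hpos i), hψ'⟩⟩
  have hψc := hdiff.1.continuous
  have hac : Continuous (coordAvg i ρ) := (hρ.coordAvg i).continuous
  -- On the fibre through `x`, the map `ψ` is the rearrangement of the restriction of `ρ`.
  have hfib : ∀ (x : T d) (t : ℝ), ψ (Function.update x i (t : UnitAddCircle)) =
      Function.update x i ((rearr (fun s : ℝ => ρ (Function.update x i (s : UnitAddCircle))) t : ℝ)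
        : UnitAddCircle) := by
    intro x t
    obtain ⟨y, rfl⟩ := proj_surjective d x
    rw [← proj_update, hψ, hΘ, shearCoord_update, proj_update, proj_update,
      Function.update_idem]
  refine ⟨ψ, hdiff, hψc.measurable, Measure.ext_of_lintegral _ fun φ hφ => ?_⟩
  rw [lintegral_map hφ hψc.measurable,
    lintegral_withDensity_eq_lintegral_mul _ (by fun_prop) (by fun_prop),
    lintegral_withDensity_eq_lintegral_mul _ (by fun_prop) hφ]
  refine lintegral_eq_of_lmarginal_eq {i} (by fun_prop) (by fun_prop) (funext fun x => ?_)
  simp only [lmarginal_singleton, Pi.mul_apply, coordAvg_update]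
  rw [lintegral_const_mul _ (by fun_prop)]
  have key := lintegral_comp_rearr (continuous_fiber hc x i) (fun _ => hpos _)
    (e := fun t => ψ (Function.update x i t) i) (fun t => by simp [hfib])
    (φ := fun t => φ (Function.update x i t)) (by fun_prop)
  refine Eq.trans (lintegral_congr fun t => ?_) key
  obtain ⟨t, rfl⟩ := QuotientAddGroup.mk_surjective t
  rw [mul_comm]
  congr 2
  erw [hfib]
  simp

/-- A positive density is transported to a constant density by a diffeomorphism: one shear for each
coordinate averages that coordinate out. -/
theorem exists_isDiffeo_measurePreserving_smul {n : ℕ} (hn : n ≠ 0) (hρ : FunContDiff n ρ)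
    (hpos : ∀ x, 0 < ρ x) :
    ∃ ψ : T d ≃ T d, IsDiffeo n ψ ∧ ∃ C : ENNReal,
      MeasurePreserving ψ ((leb d).withDensity fun x => ENNReal.ofReal (ρ x)) (C • leb d) := by
  suffices H : ∀ (s : Finset (Fin d)) (ρ : T d → ℝ), FunContDiff n ρ → (∀ x, 0 < ρ x) →
      (∀ i ∉ s, ∀ x t, ρ (Function.update x i t) = ρ x) →
      ∃ ψ : T d ≃ T d, IsDiffeo n ψ ∧ ∃ C : ENNReal,
        MeasurePreserving ψ ((leb d).withDensity fun x => ENNReal.ofReal (ρ x)) (C • leb d) from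
    H Finset.univ ρ hρ hpos (by simp)
  intro s
  induction s using Finset.induction_on with
  | empty =>
    intro ρ hρ hpos hind
    have hconst : ∀ x, ρ x = ρ 0 := by
      intro x
      have : ∀ s : Finset (Fin d), ρ (fun i => if i ∈ s then x i else 0) = ρ 0 := by
        intro s
        induction s using Finset.induction_on with
        | empty => simp; rfl
        | insert i s _ ih =>
          rw [← ih, ← hind i (by simp) (fun j => if j ∈ s then x j else 0) (x i)]
          congr 1
          funext j
          rcases eq_or_ne j i with rfl | h
          · simp
          · simp [h]
      simpa using this Finset.univ
    refine ⟨Equiv.refl _, IsDiffeo.refl _, ENNReal.ofReal (ρ 0), ?_⟩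
    simp_rw [hconst, withDensity_const]
    exact MeasurePreserving.id _
  | insert i s _ ih =>
    intro ρ hρ hpos hind
    obtain ⟨ψ, hψ, hm⟩ := exists_shear hn hρ hpos i
    obtain ⟨ψ', hψ', C, hm'⟩ := ih _ (hρ.coordAvg i) (coordAvg_pos hρ.continuous hpos i) (by
      intro j hj x t
      rcases eq_or_ne j i with rfl | h
      · exact coordAvg_update _ _ _ _
      · unfold coordAvg
        simp_rw [Function.update_comm h]
        simp_rw [hind j (by simp [h, hj])])
    exact ⟨ψ.trans ψ', hψ.trans hψ', C, hm'.comp hm⟩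

end Shear

/-! ### Transport of the Gibbs measure to Lebesgue measure -/

section Gibbs

variable {d : ℕ} {U : T d → ℝ} {κ : ℝ}

theorem integrable_of_continuous {E : Type*} [NormedAddCommGroup E] {f : T d → E}
    [SecondCountableTopologyEither (T d) E] (hf : Continuous f) (μ : Measure (T d))
    [IsFiniteMeasure μ] : Integrable f μ :=
  hf.integrable_of_hasCompactSupport (HasCompactSupport.of_compactSpace f)

theorem isProbabilityMeasure_gibbs (hU : Continuous U) : IsProbabilityMeasure (gibbs U κ) :=
  isProbabilityMeasure_tilted (integrable_of_continuous (by fun_prop) _)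

/-- The density of the Gibbs measure. -/
def gibbsDensity (U : T d → ℝ) (κ : ℝ) (x : T d) : ℝ :=
  Real.exp (-U x / κ) / ∫ x, Real.exp (-U x / κ) ∂leb d

theorem gibbs_eq_withDensity (U : T d → ℝ) (κ : ℝ) :
    gibbs U κ = (leb d).withDensity fun x => ENNReal.ofReal (gibbsDensity U κ x) := rfl

theorem gibbsDensity_pos (hU : Continuous U) (x : T d) : 0 < gibbsDensity U κ x :=
  div_pos (Real.exp_pos _) (integral_exp_pos (integrable_of_continuous (by fun_prop) _))

theorem FunContDiff.gibbsDensity {n : WithTop ℕ∞} (hU : FunContDiff n U) :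
    FunContDiff n (gibbsDensity U κ) :=
  ((ContDiff.neg hU).div_const κ).exp.div_const _

theorem exists_isDiffeo_measurePreserving_gibbs (hU : FunContDiff 2 U) (κ : ℝ) :
    ∃ ψ : T d ≃ T d, IsDiffeo 2 ψ ∧ MeasurePreserving ψ (gibbs U κ) (leb d) := by
  have := isProbabilityMeasure_gibbs (κ := κ) hU.continuous
  obtain ⟨ψ, hψ, C, hm⟩ := exists_isDiffeo_measurePreserving_smul (n := 2) two_ne_zero
    (hU.gibbsDensity (κ := κ)) (gibbsDensity_pos hU.continuous)
  rw [← gibbs_eq_withDensity] at hm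
  have hC : C = 1 := by
    have := hm.measure_preimage MeasurableSet.univ.nullMeasurableSet
    simpa using this.symm
  rw [hC, one_smul] at hm
  exact ⟨ψ, hψ, hm⟩

/-- Lebesgue measure and the Gibbs measure are comparable. -/
theorem exists_leb_le_gibbs_le (hU : Continuous U) (κ : ℝ) :
    ∃ C : ENNReal, C ≠ ⊤ ∧ leb d ≤ C • gibbs U κ ∧ gibbs U κ ≤ C • leb d := by
  have hc : Continuous (gibbsDensity U κ) := by unfold gibbsDensity; fun_prop
  have hpos := gibbsDensity_pos (κ := κ) hU
  have hc' : Continuous fun x => (gibbsDensity U κ x)⁻¹ := hc.inv₀ fun x => (hpos x).ne'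
  obtain ⟨M, hM⟩ := isCompact_univ.exists_bound_of_continuousOn hc.continuousOn
  obtain ⟨m, hm⟩ := isCompact_univ.exists_bound_of_continuousOn hc'.continuousOn
  refine ⟨ENNReal.ofReal (max M m), ENNReal.ofReal_ne_top, ?_, ?_⟩
  · rw [gibbs_eq_withDensity, ← withDensity_smul _ (by fun_prop)]
    nth_rewrite 1 [← withDensity_one (μ := leb d)]
    refine withDensity_mono (Filter.Eventually.of_forall fun x => ?_)
    have h1 : (gibbsDensity U κ x)⁻¹ ≤ max M m :=
      ((le_abs_self _).trans (hm x trivial)).trans (le_max_right _ _)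
    have h2 : 1 ≤ max M m * gibbsDensity U κ x := by
      rwa [inv_le_iff_one_le_mul₀ (hpos x)] at h1
    simp only [Pi.one_apply, Pi.smul_apply, smul_eq_mul]
    rw [← ENNReal.ofReal_mul' (hpos x).le]
    exact ENNReal.one_le_ofReal.2 h2
  · rw [gibbs_eq_withDensity, ← withDensity_const]
    refine withDensity_mono (Filter.Eventually.of_forall fun x => ENNReal.ofReal_le_ofReal ?_)
    exact ((le_abs_self _).trans (hM x trivial)).trans (le_max_left _ _)

end Gibbs

/-! ### Separable potentials -/

section Separable

variable {V : UnitAddCircle → ℝ} {κ : ℝ}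

theorem gibbs_separable (d : ℕ) (hV : Continuous V) (κ : ℝ) :
    gibbs (separable d V) κ =
      Measure.pi fun _ => AddCircle.haarAddCircle.tilted fun t => -V t / κ := by
  have hexp : ∀ x : T d, Real.exp (-separable d V x / κ) = ∏ i, Real.exp (-V (x i) / κ) := by
    intro x
    rw [← Real.exp_sum, separable, ← Finset.sum_neg_distrib, Finset.sum_div]
  have hint : Integrable (fun t => Real.exp (-V t / κ)) AddCircle.haarAddCircle :=
    Continuous.integrable_of_hasCompactSupport (by fun_prop) (HasCompactSupport.of_compactSpace _)
  have := isProbabilityMeasure_tilted hint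
  have hZ := integral_exp_pos hint
  symm
  refine Measure.pi_eq fun s hs => ?_
  rw [gibbs, tilted_apply_eq_ofReal_integral' _ (MeasurableSet.univ_pi hs)]
  simp_rw [tilted_apply_eq_ofReal_integral' _ (hs _), hexp]
  rw [← ENNReal.ofReal_prod_of_nonneg fun i _ => integral_nonneg fun t => by positivity]
  congr 1
  simp only [integral_div, leb, Measure.restrict_pi_pi]
  rw [integral_fintype_prod_eq_prod (f := fun _ t => Real.exp (-V t / κ)),
    integral_fintype_prod_eq_prod (f := fun _ t => Real.exp (-V t / κ)), Finset.prod_div_distrib]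

/-- For a separable potential the transport to Lebesgue measure acts on each coordinate by the same
circle map, and its inverse has derivative at most `exp (2 sup|V| / κ)`. -/
theorem exists_isDiffeo_measurePreserving_gibbs_separable (d : ℕ)
    (hV : ContDiff ℝ 2 fun t : ℝ => V t) {M : ℝ} (hM : ∀ t, |V t| ≤ M) (hκ : 0 < κ) :
    ∃ ψ : T d ≃ T d, IsDiffeo 2 ψ ∧ MeasurePreserving ψ (gibbs (separable d V) κ) (leb d) ∧
      ∃ g : ℝ → ℝ, ContDiff ℝ 2 g ∧ (∀ t, |deriv g t| ≤ Real.exp (2 * M / κ)) ∧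
        ∀ y, ψ.symm (proj d y) = proj d fun i => g (y i) := by
  have hVc : Continuous V := (QuotientAddGroup.isQuotientMap_mk _).continuous_iff.2 hV.continuous
  set r : UnitAddCircle → ℝ := fun t => Real.exp (-V t / κ)
  have hrc : Continuous r := by fun_prop
  have hrpos : ∀ t, 0 < r t := fun t => Real.exp_pos _
  set q : ℝ → ℝ := fun t => r t
  have hq : ContDiff ℝ 2 q := (hV.neg.div_const κ).exp
  have hqc := hq.continuous
  have hqpos : ∀ t, 0 < q t := fun t => hrpos _
  have hper : Function.Periodic q 1 := fun t => by simp [q]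
  have hQ := integral_unit_pos hqc hqpos
  -- the normalization integrals over the interval and over the circle agree
  have hQ' : ∫ t, r t ∂AddCircle.haarAddCircle = ∫ s in (0 : ℝ)..1, q s := by
    rw [intervalIntegral.integral_of_le zero_le_one,
      ← measurePreserving_coe_haar.map_eq, integral_map]
    · exact (AddCircle.measurable_mk').aemeasurable
    · exact hrc.aestronglyMeasurable
  have hG : ContDiff ℝ 2 (rearr q) := by
    have h2 : (2 : WithTop ℕ∞) = 1 + 1 := by norm_num
    rw [h2, contDiff_succ_iff_deriv]
    refine ⟨fun t => (hasDerivAt_rearr hqc t).differentiableAt, by simp, ?_⟩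
    have : deriv (rearr q) = fun t => q t / ∫ s in (0 : ℝ)..1, q s :=
      funext fun t => (hasDerivAt_rearr hqc t).deriv
    rw [this]
    exact (hq.of_le (by norm_num)).div_const _
  set e : ℝ ≃ ℝ := Equiv.ofBijective _ (bijective_rearr hqc hqpos hper)
  have he : ∀ t, e t = rearr q t := fun t => rfl
  set h : ℝ ≃ₜ ℝ := ((strictMono_rearr hqc hqpos).orderIsoOfSurjective _
    (bijective_rearr hqc hqpos hper).2).toHomeomorph
  have hhe : ∀ t, h.symm t = e.symm t := fun t => by
    rw [Equiv.eq_symm_apply]; exact h.apply_symm_apply t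
  have hne : ∀ t, q t / ∫ s in (0 : ℝ)..1, q s ≠ 0 := fun t => (div_pos (hqpos t) hQ).ne'
  have hg : ContDiff ℝ 2 e.symm := by
    rw [← funext hhe]
    exact h.contDiff_symm_deriv hne (fun t => hasDerivAt_rearr hqc t) hG
  have hg' : ∀ t, HasDerivAt e.symm (q (e.symm t) / ∫ s in (0 : ℝ)..1, q s)⁻¹ t := fun t =>
    HasDerivAt.of_local_left_inverse hg.continuous.continuousAt (hasDerivAt_rearr hqc _) (hne _)
      (Filter.Eventually.of_forall fun t => e.apply_symm_apply t)
  obtain ⟨ψ, hψ, hψ'⟩ := exists_equiv_of_lift (d := d) (Equiv.piCongrRight fun _ => e)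
    fun x k => funext fun i => rearr_add_int hqc hqpos hper _ _
  have hdiff : IsDiffeo 2 ψ := by
    refine ⟨⟨_, ?_, hψ⟩, ⟨_, ?_, hψ'⟩⟩
    · exact contDiff_pi.2 fun i => hG.comp (contDiff_apply ℝ ℝ i)
    · exact contDiff_pi.2 fun i => hg.comp (contDiff_apply ℝ ℝ i)
  refine ⟨ψ, hdiff, ?_, e.symm, hg, fun t => ?_, fun y => hψ' y⟩
  · have hpe : Function.Periodic (fun t : ℝ => ((rearr q t : ℝ) : UnitAddCircle)) 1 := fun t => by
      have := rearr_add_int hqc hqpos hper t 1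
      rw [Int.cast_one] at this
      simp [this]
    set ε : UnitAddCircle → UnitAddCircle := hpe.lift
    have hε : ∀ t : ℝ, ε t = (rearr q t : ℝ) := fun t => hpe.lift_coe t
    have hεc : Continuous ε := by
      refine (QuotientAddGroup.isQuotientMap_mk _).continuous_iff.2 ?_
      exact ((AddCircle.continuous_mk' 1).comp (continuous_rearr hqc)).congr fun t => (hε t).symm
    have hψε : (ψ : T d → T d) = fun x i => ε (x i) := by
      funext x i
      obtain ⟨y, rfl⟩ := proj_surjective d x
      rw [hψ]
      exact (hε _).symm
    rw [hψε, gibbs_separable d hVc, leb]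
    refine measurePreserving_pi _ _ fun _ => ⟨hεc.measurable,
      Measure.ext_of_lintegral _ fun φ hφ => ?_⟩
    rw [lintegral_map hφ hεc.measurable, lintegral_tilted]
    have key := lintegral_comp_rearr hrc hrpos hε hφ
    change ∫⁻ t, ENNReal.ofReal (r t / ∫ t, r t ∂AddCircle.haarAddCircle) * _ ∂_ = _
    rw [hQ']
    calc _ = ∫⁻ t, ENNReal.ofReal (∫ s in (0 : ℝ)..1, q s)⁻¹ *
          (φ (ε t) * ENNReal.ofReal (r t)) ∂AddCircle.haarAddCircle := by
          refine lintegral_congr fun t => ?_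
          rw [div_eq_inv_mul, ENNReal.ofReal_mul (inv_pos.2 hQ).le]
          ring
      _ = _ := by
          rw [lintegral_const_mul _ (by fun_prop), key, ← mul_assoc,
            ← ENNReal.ofReal_mul (inv_pos.2 hQ).le, inv_mul_cancel₀ hQ.ne']
          simp
  · rw [(hg' t).deriv, inv_div, abs_of_pos (div_pos hQ (hqpos _)), div_le_iff₀ (hqpos _)]
    have hup : ∀ s, q s ≤ Real.exp (M / κ) := fun s =>
      Real.exp_le_exp.2 (div_le_div_of_nonneg_right ((neg_le_abs _).trans (hM _)) hκ.le)
    have hlow : Real.exp (-M / κ) ≤ q (e.symm t) :=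
      Real.exp_le_exp.2 (div_le_div_of_nonneg_right (neg_le_neg ((le_abs_self _).trans (hM _)))
        hκ.le)
    calc ∫ s in (0 : ℝ)..1, q s ≤ ∫ s in (0 : ℝ)..1, Real.exp (M / κ) :=
          intervalIntegral.integral_mono_on zero_le_one (hqc.intervalIntegrable _ _)
            intervalIntegrable_const fun s _ => hup s
      _ = Real.exp (2 * M / κ) * Real.exp (-M / κ) := by
          rw [← Real.exp_add]; simp; ring
      _ ≤ _ := by gcongr

end Separable

/-! ### Expansion of integer vectors by integer matrices -/

section Expands

open Matrix

variable {ι : Type*} [Fintype ι]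

/-- The integer matrix `B` satisfies `c rⁿ ≤ |k|² |Bⁿ k|²` for every nonzero integer vector `k`. -/
def Expands (c r : ℝ) (B : Matrix ι ι ℤ) : Prop :=
  ∀ k : ι → ℤ, k ≠ 0 → ∀ n : ℕ,
    c * r ^ n ≤ (∑ i, (k i : ℝ) ^ 2) * ∑ i, (((B *ᵥ ·)^[n] k) i : ℝ) ^ 2

theorem one_le_sq_of_ne_zero {m : ℤ} (hm : m ≠ 0) : (1 : ℝ) ≤ (m : ℝ) ^ 2 := by
  have h : 0 < m ^ 2 := by positivity
  exact_mod_cast h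

theorem Expands.mono {c r c' r' : ℝ} {B : Matrix ι ι ℤ} (h : Expands c r B) (hc : 0 ≤ c)
    (hcc : c' ≤ c) (hr : 0 ≤ r') (hrr : r' ≤ r) : Expands c' r' B := fun k hk n =>
  (mul_le_mul hcc (pow_le_pow_left₀ hr hrr n) (pow_nonneg hr n) hc).trans (h k hk n)

/-- An eigenvector `ℓ` of the transpose with eigenvalue `α` gives expansion at rate `α`, provided
`ℓ(k)` is bounded below by a multiple of `|k|⁻²` on nonzero integer vectors. -/
theorem expands_of_functional {B : Matrix ι ι ℤ} {ℓ : (ι → ℤ) → ℝ} {α a b c : ℝ}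
    (hB : ∀ k, ℓ (B *ᵥ k) = α * ℓ k) (hα : 0 < α) (h0 : ℓ 0 = 0)
    (ha : ∀ k, ℓ k ^ 2 ≤ a * ∑ i, (k i : ℝ) ^ 2) (hb0 : 0 ≤ b)
    (hb : ∀ k ≠ 0, 1 ≤ b * ℓ k ^ 2 * (∑ i, (k i : ℝ) ^ 2) ^ 2)
    (ha0 : 0 ≤ a) (hc : a * b * c ^ 2 ≤ 1) : Expands c α B := by
  intro k hk n
  have hiter : ℓ ((B *ᵥ ·)^[n] k) = α ^ n * ℓ k := by
    induction n with
    | zero => simp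
    | succ n ih => rw [Function.iterate_succ_apply', hB, ih]; ring
  set v := (B *ᵥ ·)^[n] k
  set S := ∑ i, (k i : ℝ) ^ 2
  set R := ∑ i, (v i : ℝ) ^ 2
  have hS : 0 ≤ S := Finset.sum_nonneg fun i _ => sq_nonneg _
  have hR0 : 0 ≤ R := Finset.sum_nonneg fun i _ => sq_nonneg _
  have hℓ : ℓ k ≠ 0 := by
    intro h
    have := hb k hk
    simp [h] at this
    linarith
  have hv : v ≠ 0 := by
    intro h
    rw [h, h0] at hiter
    exact mul_ne_zero (pow_pos hα n).ne' hℓ hiter.symm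
  -- a nonzero integer vector has norm at least one
  have hR : 1 ≤ R := by
    obtain ⟨i, hi⟩ := Function.ne_iff.1 hv
    exact (one_le_sq_of_ne_zero hi).trans (Finset.single_le_sum (f := fun i => (v i : ℝ) ^ 2)
      (fun i _ => sq_nonneg _) (Finset.mem_univ i))
  have key : (α ^ n) ^ 2 ≤ a * b * (S * R) ^ 2 := by
    calc (α ^ n) ^ 2 = (α ^ n) ^ 2 * 1 := (mul_one _).symm
      _ ≤ (α ^ n) ^ 2 * (b * ℓ k ^ 2 * S ^ 2) := by gcongr; exact hb k hk
      _ = ℓ v ^ 2 * (b * S ^ 2) := by rw [hiter]; ring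
      _ ≤ (a * R) * (b * S ^ 2) := by gcongr; exact ha v
      _ ≤ (a * R) * (b * S ^ 2) * R := le_mul_of_one_le_right (by positivity) hR
      _ = _ := by ring
  refine (le_abs_self _).trans (abs_le_of_sq_le_sq ?_ (by positivity))
  calc (c * α ^ n) ^ 2 = c ^ 2 * (α ^ n) ^ 2 := by ring
    _ ≤ c ^ 2 * (a * b * (S * R) ^ 2) := by gcongr
    _ = (a * b * c ^ 2) * (S * R) ^ 2 := by ring
    _ ≤ 1 * (S * R) ^ 2 := by gcongr
    _ = _ := one_mul _

theorem Expands.reindex {κ : Type*} [Fintype κ] {c r : ℝ} {B : Matrix ι ι ℤ} (h : Expands c r B)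
    (e : ι ≃ κ) : Expands c r (Matrix.reindex e e B) := by
  intro k hk n
  have hstep : ∀ n, (fun i => ((Matrix.reindex e e B *ᵥ ·)^[n] k) (e i)) =
      (B *ᵥ ·)^[n] fun i => k (e i) := by
    intro n
    induction n with
    | zero => rfl
    | succ n ih =>
      rw [Function.iterate_succ_apply', Function.iterate_succ_apply', ← ih]
      funext i
      simp only [Matrix.mulVec, dotProduct]
      rw [← Equiv.sum_comp e]
      simp
  have hk' : (fun i => k (e i)) ≠ 0 := by
    obtain ⟨i, hi⟩ := Function.ne_iff.1 hk
    exact Function.ne_iff.2 ⟨e.symm i, by simpa using hi⟩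
  have := h _ hk' n
  rw [← hstep] at this
  rwa [Equiv.sum_comp e (fun i => (k i : ℝ) ^ 2),
    Equiv.sum_comp e (fun i => (((Matrix.reindex e e B *ᵥ ·)^[n] k) i : ℝ) ^ 2)] at this

theorem blockDiagonal'_mulVec_apply {o : Type*} [Fintype o] [DecidableEq o] {m : o → Type*}
    [∀ i, Fintype (m i)] {R : Type*} [NonUnitalNonAssocSemiring R] (B : ∀ i, Matrix (m i) (m i) R)
    (v : (Σ i, m i) → R) (i : o) (a : m i) :
    (blockDiagonal' B *ᵥ v) ⟨i, a⟩ = (B i *ᵥ fun b => v ⟨i, b⟩) a := by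
  simp only [Matrix.mulVec, dotProduct, Fintype.sum_sigma]
  rw [Finset.sum_eq_single i]
  · simp [blockDiagonal'_apply_eq]
  · intro j _ hj
    exact Finset.sum_eq_zero fun b _ => by rw [blockDiagonal'_apply_ne _ _ _ hj.symm, zero_mul]
  · simp

theorem Expands.blockDiagonal' {o : Type*} [Fintype o] [DecidableEq o] {m : o → Type*}
    [∀ i, Fintype (m i)] {c r : ℝ} {B : ∀ i, Matrix (m i) (m i) ℤ} (h : ∀ i, Expands c r (B i)) :
    Expands c r (blockDiagonal' B) := by
  intro k hk n
  have hstep : ∀ i, (fun a => ((Matrix.blockDiagonal' B *ᵥ ·)^[n] k) ⟨i, a⟩) =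
      (B i *ᵥ ·)^[n] fun a => k ⟨i, a⟩ := by
    intro i
    induction n with
    | zero => rfl
    | succ n ih =>
      rw [Function.iterate_succ_apply', Function.iterate_succ_apply', ← ih]
      exact funext fun a => blockDiagonal'_mulVec_apply B _ i a
  obtain ⟨⟨i, a⟩, hi⟩ := Function.ne_iff.1 hk
  have hk' : (fun a => k ⟨i, a⟩) ≠ 0 := Function.ne_iff.2 ⟨a, hi⟩
  refine (h i _ hk' n).trans ?_
  rw [← hstep i]
  have hle : ∀ f : (Σ i, m i) → ℝ, (∀ x, 0 ≤ f x) → ∑ a, f ⟨i, a⟩ ≤ ∑ x, f x := by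
    intro f hf
    rw [Fintype.sum_sigma]
    exact Finset.single_le_sum (f := fun i => ∑ a, f ⟨i, a⟩)
      (fun i _ => Finset.sum_nonneg fun a _ => hf _) (Finset.mem_univ i)
  exact mul_le_mul (hle (fun x => (k x : ℝ) ^ 2) fun _ => sq_nonneg _)
    (hle (fun x => (((Matrix.blockDiagonal' B *ᵥ ·)^[n] k) x : ℝ) ^ 2) fun _ => sq_nonneg _)
    (Finset.sum_nonneg fun _ _ => sq_nonneg _) (Finset.sum_nonneg fun _ _ => sq_nonneg _)

/-- Descent at the prime two: a homogeneous form that is anisotropic modulo two has no nontrivial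
integer zero. -/
theorem eq_zero_of_descent {ι : Type*} {N : (ι → ℤ) → ℤ} {p : ℕ} (hN : ∀ k, N (2 • k) = 2 ^ p * N k)
    (heven : ∀ k, N k = 0 → ∀ i, 2 ∣ k i) {k : ι → ℤ} (hk : N k = 0) : k = 0 := by
  have h : ∀ n : ℕ, ∃ k', k = 2 ^ n • k' ∧ N k' = 0 := by
    intro n
    induction n with
    | zero => exact ⟨k, by simp, hk⟩
    | succ n ih =>
      obtain ⟨k', hk', h0⟩ := ih
      choose l hl using heven k' h0
      have hl' : k' = 2 • l := funext fun i => by simp [hl i]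
      refine ⟨l, by rw [hk', hl', pow_succ, mul_smul], ?_⟩
      rw [hl', hN] at h0
      exact (mul_eq_zero.1 h0).resolve_left (by positivity)
  funext i
  obtain ⟨k', hk', -⟩ := h (k i).natAbs
  refine Int.eq_zero_of_abs_lt_dvd (m := 2 ^ (k i).natAbs) ⟨k' i, ?_⟩ ?_
  · conv_lhs => rw [hk']
    simp
  · rw [Int.abs_eq_natAbs]
    exact_mod_cast Nat.lt_two_pow_self

/-- The blocks of size two and three: companion matrices of `X² - 3X + 1` and of `X³ - X - 1`
(the value at other sizes is irrelevant). -/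
def companionBlock : ∀ s : ℕ, Matrix (Fin s) (Fin s) ℤ
  | 2 => !![0, 1; -1, 3]
  | 3 => !![0, 1, 0; 0, 0, 1; 1, 1, 0]
  | _ => 1

theorem det_companionBlock {s : ℕ} (hs : s = 2 ∨ s = 3) : (companionBlock s).det = 1 := by
  rcases hs with rfl | rfl
  · simp [companionBlock, Matrix.det_fin_two]
  · simp [companionBlock, Matrix.det_fin_three]

theorem exists_expands_companionBlock_two :
    ∃ c : ℝ, 0 < c ∧ Expands c (13 / 10) (companionBlock 2)ᵀ := by
  -- `α` is the larger root of `X² - 3X + 1`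
  obtain ⟨α, hα, h1, h2⟩ : ∃ α : ℝ, α ^ 2 = 3 * α - 1 ∧ 2 ≤ α ∧ α ≤ 3 := by
    have h5 : Real.sqrt 5 ^ 2 = 5 := Real.sq_sqrt (by norm_num)
    have h0 := Real.sqrt_nonneg 5
    exact ⟨(3 + Real.sqrt 5) / 2, by nlinarith, by nlinarith, by nlinarith⟩
  have hN : ∀ k : Fin 2 → ℤ, k 0 ^ 2 + 3 * k 0 * k 1 + k 1 ^ 2 = 0 → k = 0 := fun k hk => by
    refine eq_zero_of_descent (N := fun k : Fin 2 → ℤ => k 0 ^ 2 + 3 * k 0 * k 1 + k 1 ^ 2)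
      (p := 2) (fun k => by simp; ring) (fun k hk => ?_) hk
    have hdec : ∀ a b : ZMod 2, a ^ 2 + 3 * a * b + b ^ 2 = 0 → a = 0 ∧ b = 0 := by decide
    have := congrArg (Int.cast : ℤ → ZMod 2) hk
    push_cast at this
    obtain ⟨ha, hb⟩ := hdec _ _ this
    intro i
    rw [← Nat.cast_ofNat, ← ZMod.intCast_zmod_eq_zero_iff_dvd]
    fin_cases i <;> assumption
  refine ⟨1 / 100, by norm_num, Expands.mono (r := α) (c := 1 / 100) ?_ (by norm_num) le_rfl
    (by norm_num) (by linarith)⟩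
  refine expands_of_functional (ℓ := fun k => k 0 + α * k 1) (a := 10) (b := 2) ?_ (by linarith)
    (by simp) ?_ (by norm_num) ?_ (by norm_num) (by norm_num)
  · intro k
    simp [companionBlock, Matrix.mulVec, dotProduct, Fin.sum_univ_two]
    linear_combination -(k 1 : ℝ) * hα
  · intro k
    simp only [Fin.sum_univ_two]
    nlinarith [sq_nonneg (α * k 0 - k 1), sq_nonneg (k 0 : ℝ), sq_nonneg (k 1 : ℝ)]
  · intro k hk
    simp only [Fin.sum_univ_two]
    set x : ℝ := (k 0 : ℝ)
    set y : ℝ := (k 1 : ℝ)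
    have hn : (1 : ℝ) ≤ (x ^ 2 + 3 * x * y + y ^ 2) ^ 2 := by
      have h := one_le_sq_of_ne_zero (mt (hN k) hk)
      push_cast at h
      exact h
    have hfac : x ^ 2 + 3 * x * y + y ^ 2 = (x + α * y) * (x + (3 - α) * y) := by
      linear_combination y ^ 2 * hα
    have hS : 1 ≤ x ^ 2 + y ^ 2 := by
      obtain ⟨i, hi⟩ := Function.ne_iff.1 hk
      have h' := one_le_sq_of_ne_zero hi
      fin_cases i
      · exact h'.trans (le_add_of_nonneg_right (sq_nonneg _))
      · exact h'.trans (le_add_of_nonneg_left (sq_nonneg _))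
    have hQ : (x + (3 - α) * y) ^ 2 ≤ 2 * (x ^ 2 + y ^ 2) ^ 2 := by
      have hQ1 : (x + (3 - α) * y) ^ 2 ≤ 2 * (x ^ 2 + y ^ 2) := by
        have : (3 - α) ^ 2 ≤ 1 := by nlinarith
        nlinarith [sq_nonneg (x - (3 - α) * y), mul_le_mul_of_nonneg_right this (sq_nonneg y)]
      nlinarith
    rw [hfac, mul_pow] at hn
    calc (1 : ℝ) ≤ _ := hn
      _ ≤ (x + α * y) ^ 2 * (2 * (x ^ 2 + y ^ 2) ^ 2) := by gcongr
      _ = _ := by ring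

theorem exists_expands_companionBlock_three :
    ∃ c : ℝ, 0 < c ∧ Expands c (13 / 10) (companionBlock 3)ᵀ := by
  -- `α` is the real root of `X³ - X - 1`
  obtain ⟨α, ⟨h1, h2⟩, hα⟩ : ∃ α ∈ Set.Icc (13 / 10 : ℝ) (14 / 10), α ^ 3 - α - 1 = 0 :=
    intermediate_value_Icc (by norm_num) (f := fun α : ℝ => α ^ 3 - α - 1) (by fun_prop)
      ⟨by norm_num, by norm_num⟩
  -- the norm form of `ℤ[α]` in the basis `1, α, α²`
  have hN : ∀ k : Fin 3 → ℤ, k 0 ^ 3 + k 1 ^ 3 + k 2 ^ 3 + 2 * k 0 ^ 2 * k 2 - k 0 * k 1 ^ 2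
      - 3 * k 0 * k 1 * k 2 + k 0 * k 2 ^ 2 - k 1 * k 2 ^ 2 = 0 → k = 0 := fun k hk => by
    refine eq_zero_of_descent (N := fun k : Fin 3 → ℤ => k 0 ^ 3 + k 1 ^ 3 + k 2 ^ 3
      + 2 * k 0 ^ 2 * k 2 - k 0 * k 1 ^ 2 - 3 * k 0 * k 1 * k 2 + k 0 * k 2 ^ 2 - k 1 * k 2 ^ 2)
      (p := 3) (fun k => by simp; ring) (fun k hk => ?_) hk
    have hdec : ∀ a b c : ZMod 2, a ^ 3 + b ^ 3 + c ^ 3 + 2 * a ^ 2 * c - a * b ^ 2 - 3 * a * b * c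
      + a * c ^ 2 - b * c ^ 2 = 0 → a = 0 ∧ b = 0 ∧ c = 0 := by decide
    have := congrArg (Int.cast : ℤ → ZMod 2) hk
    push_cast at this
    obtain ⟨ha, hb, hc⟩ := hdec _ _ _ this
    intro i
    rw [← Nat.cast_ofNat, ← ZMod.intCast_zmod_eq_zero_iff_dvd]
    fin_cases i <;> assumption
  have hsq : α ^ 2 ≤ 2 := by nlinarith
  refine ⟨1 / 100, by norm_num, Expands.mono (r := α) (c := 1 / 100) ?_ (by norm_num) le_rfl
    (by norm_num) h1⟩
  refine expands_of_functional (ℓ := fun k => k 0 + α * k 1 + α ^ 2 * k 2) (a := 7) (b := 100) ?_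
    (by linarith) (by simp) ?_ (by norm_num) ?_ (by norm_num) (by norm_num)
  · intro k
    simp [companionBlock, Matrix.mulVec, dotProduct, Fin.sum_univ_three]
    linear_combination -(k 2 : ℝ) * hα
  · intro k
    simp only [Fin.sum_univ_three]
    set x : ℝ := (k 0 : ℝ)
    set y : ℝ := (k 1 : ℝ)
    set z : ℝ := (k 2 : ℝ)
    have hcs : (x + α * y + α ^ 2 * z) ^ 2 ≤
        (1 + α ^ 2 + (α ^ 2) ^ 2) * (x ^ 2 + y ^ 2 + z ^ 2) := by
      nlinarith [sq_nonneg (α * x - y), sq_nonneg (α ^ 2 * x - z),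
        sq_nonneg (α ^ 2 * y - α * z)]
    have : 1 + α ^ 2 + (α ^ 2) ^ 2 ≤ 7 := by nlinarith [sq_nonneg α]
    exact hcs.trans (mul_le_mul_of_nonneg_right this (by positivity))
  · intro k hk
    simp only [Fin.sum_univ_three]
    set x : ℝ := (k 0 : ℝ)
    set y : ℝ := (k 1 : ℝ)
    set z : ℝ := (k 2 : ℝ)
    have hn : (1 : ℝ) ≤ (x ^ 3 + y ^ 3 + z ^ 3 + 2 * x ^ 2 * z - x * y ^ 2
        - 3 * x * y * z + x * z ^ 2 - y * z ^ 2) ^ 2 := by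
      have h := one_le_sq_of_ne_zero (mt (hN k) hk)
      push_cast at h
      exact h
    set Q := x ^ 2 - α * (x * y) + (2 - α ^ 2) * (x * z) + (α ^ 2 - 1) * y ^ 2 - y * z
      + (1 + α - α ^ 2) * z ^ 2 with hQdef
    have hfac : x ^ 3 + y ^ 3 + z ^ 3 + 2 * x ^ 2 * z - x * y ^ 2
        - 3 * x * y * z + x * z ^ 2 - y * z ^ 2 = (x + α * y + α ^ 2 * z) * Q := by
      rw [hQdef]
      linear_combination (2 * x * y * z + α * x * z ^ 2 - y ^ 3 - α * y ^ 2 * z + y * z ^ 2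
        - (1 - α) * z ^ 3) * hα
    have hQ : Q ^ 2 ≤ 100 * (x ^ 2 + y ^ 2 + z ^ 2) ^ 2 := by
      have hterm : ∀ c u v : ℝ, |c| ≤ 2 → |c * (u * v)| ≤ u ^ 2 + v ^ 2 := by
        intro c u v hc
        rw [abs_mul, abs_mul]
        nlinarith [mul_le_mul_of_nonneg_right hc (mul_nonneg (abs_nonneg u) (abs_nonneg v)),
          sq_nonneg (|u| - |v|), sq_abs u, sq_abs v]
      have e1 := abs_le.1 (hterm 1 x x (by norm_num))
      have e2 := abs_le.1 (hterm α x y (abs_le.2 ⟨by linarith, by linarith⟩))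
      have e3 := abs_le.1 (hterm (2 - α ^ 2) x z (abs_le.2 ⟨by nlinarith, by nlinarith⟩))
      have e4 := abs_le.1 (hterm (α ^ 2 - 1) y y (abs_le.2 ⟨by nlinarith, by nlinarith⟩))
      have e5 := abs_le.1 (hterm 1 y z (by norm_num))
      have e6 := abs_le.1 (hterm (1 + α - α ^ 2) z z (abs_le.2 ⟨by nlinarith, by nlinarith⟩))
      have hx := sq_nonneg x
      have hy := sq_nonneg y
      have hz := sq_nonneg z
      have : Q ^ 2 ≤ (10 * (x ^ 2 + y ^ 2 + z ^ 2)) ^ 2 :=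
        sq_le_sq.2 (by
          rw [abs_of_nonneg (a := 10 * (x ^ 2 + y ^ 2 + z ^ 2)) (by positivity)]
          refine abs_le.2 ⟨?_, ?_⟩ <;> rw [hQdef] <;> linarith [e1.1, e1.2, e2.1, e2.2])
      linarith
    rw [hfac, mul_pow] at hn
    calc (1 : ℝ) ≤ _ := hn
      _ ≤ (x + α * y + α ^ 2 * z) ^ 2 * (100 * (x ^ 2 + y ^ 2 + z ^ 2) ^ 2) := by gcongr
      _ = _ := by ring

/-- The companion blocks have no eigenvalue on the unit circle. -/
theorem norm_ne_one_of_companionBlock_mulVec {s : ℕ} (hs : s = 2 ∨ s = 3) {z : ℂ} {v : Fin s → ℂ}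
    (hv : v ≠ 0) (h : (companionBlock s).map (Int.cast : ℤ → ℂ) *ᵥ v = z • v) : ‖z‖ ≠ 1 := by
  intro hz
  rcases hs with rfl | rfl
  · have h0 := congrFun h 0
    have h1 := congrFun h 1
    simp [companionBlock, Matrix.mulVec, dotProduct, Fin.sum_univ_two] at h0 h1
    have hv0 : v 0 ≠ 0 := by
      intro h'
      refine hv (funext fun i => ?_)
      fin_cases i <;> simp [h', h0]
    have hp : z ^ 2 + 1 = 3 * z := mul_right_cancel₀ hv0 (by rw [h0] at h1; linear_combination -h1)
    have hle : ‖3 * z‖ ≤ 1 + 1 := by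
      rw [← hp]
      exact (norm_add_le _ _).trans (by simp [hz])
    rw [norm_mul, hz] at hle
    norm_num at hle
  · have h0 := congrFun h 0
    have h1 := congrFun h 1
    have h2 := congrFun h 2
    simp [companionBlock, Matrix.mulVec, dotProduct, Fin.sum_univ_three] at h0 h1 h2
    have hv0 : v 0 ≠ 0 := by
      intro h'
      refine hv (funext fun i => ?_)
      fin_cases i <;> simp [h', h0, h1]
    have hp : z ^ 3 = z + 1 :=
      mul_right_cancel₀ hv0 (by rw [h1, h0] at h2; linear_combination -h2)
    -- `|z| = |z + 1| = 1` forces `z² + z + 1 = 0`, hence `z³ = 1` and `z = 0`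
    have hnz : z.re ^ 2 + z.im ^ 2 = 1 := by
      have := Complex.sq_norm z
      rw [hz, Complex.normSq_apply] at this
      linarith
    have hnz1 : (z.re + 1) ^ 2 + z.im ^ 2 = 1 := by
      have := Complex.sq_norm (z + 1)
      rw [← hp, norm_pow, hz, hp, Complex.normSq_apply] at this
      simp at this
      linarith
    have hre : z.re = -1 / 2 := by linarith
    have hq : z ^ 2 + z + 1 = 0 := by
      apply Complex.ext
      · simp [pow_two]; nlinarith
      · simp [pow_two, hre]; ring
    have hz0 : z = 0 := by linear_combination -hp + (z - 1) * hq
    simp [hz0] at hz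

theorem det_blockDiagonal'_eq_one {m : ℕ} {s : Fin m → ℕ}
    {B : ∀ i, Matrix (Fin (s i)) (Fin (s i)) ℤ} (h : ∀ i, (B i).det = 1) :
    (blockDiagonal' B).det = 1 := by
  rw [(blockTriangular_blockDiagonal' B).det]
  refine Finset.prod_eq_one fun i _ => ?_
  rw [← h i, ← Matrix.det_submatrix_equiv_self (Equiv.sigmaSubtype i).symm]
  congr 1
  ext a b
  simp [Matrix.toSquareBlock, Matrix.toSquareBlockProp, Equiv.sigmaSubtype, blockDiagonal'_apply_eq]

theorem exists_sizes_two_three {d : ℕ} (hd : 2 ≤ d) :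
    ∃ (m : ℕ) (s : Fin m → ℕ), ∑ i, s i = d ∧ ∀ i, s i = 2 ∨ s i = 3 := by
  obtain ⟨m, rfl | rfl⟩ := Nat.even_or_odd' d
  · exact ⟨m, fun _ => 2, by simp [mul_comm], fun _ => Or.inl rfl⟩
  · obtain ⟨m, rfl⟩ : ∃ n, m = n + 1 := ⟨m - 1, by omega⟩
    refine ⟨m + 1, Fin.cons 3 fun _ => 2, ?_, Fin.cases (Or.inr rfl) fun _ => Or.inl rfl⟩
    simp [Fin.sum_univ_succ]
    ring

/-- One expansion constant serves matrices of every size. -/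
theorem exists_hyperbolic_matrix :
    ∃ c : ℝ, 0 < c ∧ ∀ d : ℕ, 2 ≤ d → ∃ A : Matrix.SpecialLinearGroup (Fin d) ℤ,
      IsHyperbolic A.1 ∧ IsBlockDiagonalTwoThree A.1 ∧ Expands c (13 / 10) A.1ᵀ := by
  obtain ⟨c₂, hc₂, h₂⟩ := exists_expands_companionBlock_two
  obtain ⟨c₃, hc₃, h₃⟩ := exists_expands_companionBlock_three
  refine ⟨min c₂ c₃, lt_min hc₂ hc₃, fun d hd => ?_⟩
  obtain ⟨m, s, hs, hs'⟩ := exists_sizes_two_three hd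
  set e := finSigmaFinEquiv.trans (finCongr hs)
  set M := Matrix.blockDiagonal' fun i => companionBlock (s i)
  have hM : M.det = 1 := det_blockDiagonal'_eq_one fun i => det_companionBlock (hs' i)
  refine ⟨⟨Matrix.reindex e e M, by rw [Matrix.det_reindex_self, hM]⟩, ?_,
    ⟨m, s, hs, _, hs', rfl⟩, ?_⟩
  · intro z hz
    obtain ⟨v, hv⟩ := hz.exists_hasEigenvector
    obtain ⟨j, hj⟩ := Function.ne_iff.1 hv.2
    have hev := hv.apply_eq_smul
    rw [Matrix.toLin'_apply] at hev
    obtain ⟨⟨i, a⟩, rfl⟩ := e.surjective j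
    refine norm_ne_one_of_companionBlock_mulVec (hs' i) (v := fun a => v (e ⟨i, a⟩))
      (Function.ne_iff.2 ⟨a, hj⟩) (funext fun b => ?_)
    have hb := congrFun hev (e ⟨i, b⟩)
    rw [← blockDiagonal'_mulVec_apply (fun i => (companionBlock (s i)).map (Int.cast : ℤ → ℂ))
      (fun x => v (e x)), ← blockDiagonal'_map _ _ Int.cast_zero]
    refine Eq.trans ?_ hb
    simp only [Matrix.mulVec, dotProduct]
    rw [← Equiv.sum_comp e]
    simp [M]
  · change Expands _ _ (Matrix.reindex e e Mᵀ)
    refine Expands.reindex ?_ e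
    rw [blockDiagonal'_transpose]
    refine Expands.blockDiagonal' fun i => ?_
    have h3 : ∀ s, s = 2 ∨ s = 3 → Expands (min c₂ c₃) (13 / 10) (companionBlock s)ᵀ := by
      rintro s (rfl | rfl)
      · exact h₂.mono hc₂.le (min_le_left _ _) (by norm_num) le_rfl
      · exact h₃.mono hc₃.le (min_le_right _ _) (by norm_num) le_rfl
    exact h3 _ (hs' i)

end Expands

/-! ### Derivatives and Fourier coefficients on the torus -/

section Fourier

open UnitAddTorus Filter Topology
open scoped ComplexConjugate

variable {d : ℕ}

instance : (leb d).IsAddHaarMeasure := by unfold leb; infer_instance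

theorem memLp_of_continuous {E : Type*} [NormedAddCommGroup E] {f : T d → E}
    [SecondCountableTopologyEither (T d) E] (hf : Continuous f) (μ : Measure (T d))
    [IsFiniteMeasure μ] : MemLp f 2 μ := by
  obtain ⟨C, hC⟩ := isCompact_univ.exists_bound_of_continuousOn hf.continuousOn
  exact MemLp.of_bound hf.aestronglyMeasurable C (Eventually.of_forall fun x => hC x trivial)

/-- The partial derivative `∂ⱼ u` of a complex function on the torus. -/
def torusDeriv (j : Fin d) (u : T d → ℂ) (x : T d) : ℂ :=
  deriv (fun t : ℝ => u (x + Pi.single j (t : UnitAddCircle))) 0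

theorem proj_add_smul_single (y : Fin d → ℝ) (j : Fin d) (t : ℝ) :
    proj d (y + t • Pi.single j 1) = proj d y + Pi.single j (t : UnitAddCircle) := by
  funext i
  rcases eq_or_ne i j with rfl | h
  · simp [proj]
  · simp [proj, h]

variable {u v : T d → ℂ}

theorem hasDerivAt_torus_aux (hu : ContDiff ℝ 1 fun y => u (proj d y)) (y : Fin d → ℝ)
    (j : Fin d) (t : ℝ) :
    HasDerivAt (fun t : ℝ => u (proj d y + Pi.single j (t : UnitAddCircle)))
      (fderiv ℝ (fun y => u (proj d y)) (y + t • Pi.single j 1) (Pi.single j 1)) t := by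
  simp_rw [← proj_add_smul_single]
  refine HasFDerivAt.comp_hasDerivAt (l := fun y => u (proj d y)) t
    ((hu.differentiable one_ne_zero).differentiableAt.hasFDerivAt) ?_
  simpa using ((hasDerivAt_id t).smul_const (Pi.single j (1 : ℝ) : Fin d → ℝ)).const_add y

theorem torusDeriv_proj (hu : ContDiff ℝ 1 fun y => u (proj d y)) (y : Fin d → ℝ) (j : Fin d) :
    torusDeriv j u (proj d y) = fderiv ℝ (fun y => u (proj d y)) y (Pi.single j 1) := by
  exact (hasDerivAt_torus_aux hu y j 0).deriv.trans (by simp)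

theorem hasDerivAt_torusDeriv (hu : ContDiff ℝ 1 fun y => u (proj d y)) (x : T d) (j : Fin d)
    (t : ℝ) : HasDerivAt (fun t : ℝ => u (x + Pi.single j (t : UnitAddCircle)))
      (torusDeriv j u (x + Pi.single j (t : UnitAddCircle))) t := by
  obtain ⟨y, rfl⟩ := proj_surjective d x
  rw [← proj_add_smul_single, torusDeriv_proj hu]
  exact hasDerivAt_torus_aux hu y j t

theorem continuous_torusDeriv (hu : ContDiff ℝ 1 fun y => u (proj d y)) (j : Fin d) :
    Continuous (torusDeriv j u) := by
  refine continuous_of_lift ?_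
  simp_rw [torusDeriv_proj hu]
  exact (hu.continuous_fderiv one_ne_zero).clm_apply continuous_const

/-- Derivatives integrate to zero, since translations preserve Lebesgue measure. -/
theorem integral_torusDeriv (hu : ContDiff ℝ 1 fun y => u (proj d y)) (j : Fin d) :
    ∫ x, torusDeriv j u x ∂leb d = 0 := by
  have huc : Continuous u := continuous_of_lift hu.continuous
  have hdc := continuous_torusDeriv hu j
  obtain ⟨C, hC⟩ := isCompact_univ.exists_bound_of_continuousOn hdc.continuousOn
  have hsh : ∀ t : ℝ, Continuous fun x : T d => x + Pi.single j (t : UnitAddCircle) :=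
    fun t => continuous_id.add continuous_const
  have hmeas : ∀ᶠ t : ℝ in 𝓝 0, AEStronglyMeasurable
      (fun x => u (x + Pi.single j (t : UnitAddCircle))) (leb d) :=
    Eventually.of_forall fun t => (huc.comp (hsh t)).aestronglyMeasurable
  have hint : Integrable (fun x => u (x + Pi.single j ((0 : ℝ) : UnitAddCircle))) (leb d) :=
    integrable_of_continuous (huc.comp (hsh 0)) _
  have hmeas' : AEStronglyMeasurable
      (fun x => torusDeriv j u (x + Pi.single j ((0 : ℝ) : UnitAddCircle))) (leb d) :=
    (hdc.comp (hsh 0)).aestronglyMeasurable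
  have hbound : ∀ᵐ x ∂leb d, ∀ t ∈ (Set.univ : Set ℝ),
      ‖torusDeriv j u (x + Pi.single j (t : UnitAddCircle))‖ ≤ C :=
    ae_of_all _ fun x t _ => hC _ (Set.mem_univ _)
  have hder : ∀ᵐ x ∂leb d, ∀ t ∈ (Set.univ : Set ℝ),
      HasDerivAt (fun t : ℝ => u (x + Pi.single j (t : UnitAddCircle)))
        (torusDeriv j u (x + Pi.single j (t : UnitAddCircle))) t :=
    ae_of_all _ fun x t _ => hasDerivAt_torusDeriv hu x j t
  have h := (hasDerivAt_integral_of_dominated_loc_of_deriv_le univ_mem hmeas hint hmeas' hbound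
    (integrable_const C) hder).2
  have hconst : (fun t : ℝ => ∫ x, u (x + Pi.single j (t : UnitAddCircle)) ∂leb d) =
      fun _ => ∫ x, u x ∂leb d := funext fun t => integral_add_right_eq_self u _
  rw [hconst] at h
  simpa using h.unique (hasDerivAt_const _ _)

theorem torusDeriv_mul (hu : ContDiff ℝ 1 fun y => u (proj d y))
    (hv : ContDiff ℝ 1 fun y => v (proj d y)) (j : Fin d) (x : T d) :
    torusDeriv j (fun x => u x * v x) x = torusDeriv j u x * v x + u x * torusDeriv j v x := by
  have h := (hasDerivAt_torusDeriv hu x j 0).mul (hasDerivAt_torusDeriv hv x j 0)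
  exact h.deriv.trans (by simp)

theorem mFourier_proj (k : Fin d → ℤ) (y : Fin d → ℝ) :
    mFourier k (proj d y) = ∏ i, Complex.exp (2 * Real.pi * Complex.I * k i * y i) := by
  simp [mFourier, proj]

theorem contDiff_mFourier {n : WithTop ℕ∞} (k : Fin d → ℤ) :
    ContDiff ℝ n fun y => mFourier k (proj d y) := by
  simp_rw [mFourier_proj]
  refine contDiff_prod fun i _ => ContDiff.cexp (contDiff_const.mul ?_)
  exact Complex.ofRealCLM.contDiff.comp (contDiff_apply ℝ ℝ i)

theorem torusDeriv_mFourier (k : Fin d → ℤ) (j : Fin d) (x : T d) :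
    torusDeriv j (mFourier k) x = 2 * Real.pi * Complex.I * k j * mFourier k x := by
  have hmul : ∀ t : ℝ, mFourier k (x + Pi.single j (t : UnitAddCircle)) =
      mFourier k x * Complex.exp (2 * Real.pi * Complex.I * k j * t) := by
    intro t
    have h1 : ∀ i, fourier (k i) ((x + Pi.single j (t : UnitAddCircle) : T d) i) =
        fourier (k i) (x i) *
          if i = j then Complex.exp (2 * Real.pi * Complex.I * k j * t) else 1 := by
      intro i
      rcases eq_or_ne i j with rfl | h
      · rw [Pi.add_apply, Pi.single_eq_same, if_pos rfl]
        have : (fourier (k i) (t : UnitAddCircle) : ℂ) =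
            Complex.exp (2 * Real.pi * Complex.I * k i * t) := by simp
        rw [← this, fourier_apply, fourier_apply, fourier_apply, smul_add, AddCircle.toCircle_add,
          Circle.coe_mul]
      · simp [h]
    simp only [mFourier, ContinuousMap.coe_mk, h1, Finset.prod_mul_distrib]
    simp
  unfold torusDeriv
  simp_rw [hmul]
  have h : HasDerivAt (fun t : ℝ => Complex.exp (2 * Real.pi * Complex.I * k j * t))
      (2 * Real.pi * Complex.I * k j) 0 := by
    have h1 : HasDerivAt (fun t : ℝ => 2 * Real.pi * Complex.I * k j * (t : ℂ))
        (2 * Real.pi * Complex.I * k j) 0 := by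
      simpa using (Complex.ofRealCLM.hasDerivAt (x := 0)).const_mul (2 * Real.pi * Complex.I * k j)
    simpa using h1.cexp
  rw [(h.const_mul _).deriv]
  ring

/-- The Fourier coefficient of `u` at `k`, with respect to the measure `leb`. -/
def fc (u : T d → ℂ) (k : Fin d → ℤ) : ℂ := ∫ x, mFourier (-k) x * u x ∂leb d

theorem norm_mFourier_apply (k : Fin d → ℤ) (x : T d) : ‖mFourier k x‖ = 1 := by
  simp [mFourier, fourier_apply, -fourier_coe_apply', Circle.norm_coe]

theorem fc_torusDeriv (hu : ContDiff ℝ 1 fun y => u (proj d y)) (j : Fin d) (k : Fin d → ℤ) :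
    fc (torusDeriv j u) k = 2 * Real.pi * Complex.I * k j * fc u k := by
  have huc : Continuous u := continuous_of_lift hu.continuous
  have hdc := continuous_torusDeriv hu j
  have h := integral_torusDeriv (u := fun x => mFourier (-k) x * u x)
    ((contDiff_mFourier (-k)).mul hu) j
  simp_rw [torusDeriv_mul (contDiff_mFourier (-k)) hu, torusDeriv_mFourier] at h
  rw [integral_add (integrable_of_continuous (by fun_prop) _)
    (integrable_of_continuous (by fun_prop) _)] at h
  simp_rw [mul_assoc _ _ (u _)] at h
  rw [integral_const_mul] at h
  have h' : fc (torusDeriv j u) k = -(2 * Real.pi * Complex.I * ((-k) j : ℤ) * fc u k) :=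
    eq_neg_of_add_eq_zero_right h
  rw [h']
  push_cast [Pi.neg_apply]
  ring

theorem fc_congr_ae (h : u =ᵐ[leb d] v) (k : Fin d → ℤ) : fc u k = fc v k :=
  integral_congr_ae (by filter_upwards [h] with x hx; rw [hx])

/-- Parseval's identity. -/
theorem hasSum_conj_fc_mul_fc (hu : MemLp u 2 (leb d)) (hv : MemLp v 2 (leb d)) :
    HasSum (fun k => conj (fc u k) * fc v k) (∫ x, conj (u x) * v x ∂leb d) := by
  have h : HasSum (fun k => conj (fc (hu.toLp u) k) * fc (hv.toLp v) k)
      (∫ x, conj (hu.toLp u x) * hv.toLp v x ∂leb d) :=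
    UnitAddTorus.hasSum_prod_mFourierCoeff (hu.toLp u) (hv.toLp v)
  have he : ∫ x, conj (hu.toLp u x) * hv.toLp v x ∂leb d = ∫ x, conj (u x) * v x ∂leb d :=
    integral_congr_ae (by
      filter_upwards [hu.coeFn_toLp, hv.coeFn_toLp] with x h1 h2
      rw [h1, h2])
  simp_rw [he, fc_congr_ae hu.coeFn_toLp, fc_congr_ae hv.coeFn_toLp] at h
  exact h

theorem hasSum_norm_fc_sq (hu : MemLp u 2 (leb d)) :
    HasSum (fun k => ‖fc u k‖ ^ 2) (∫ x, ‖u x‖ ^ 2 ∂leb d) := by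
  have h := hasSum_conj_fc_mul_fc hu hu
  simp_rw [Complex.conj_mul'] at h
  have he : ∫ x, (‖u x‖ : ℂ) ^ 2 ∂leb d = ((∫ x, ‖u x‖ ^ 2 ∂leb d : ℝ) : ℂ) := by
    rw [← integral_complex_ofReal]
    push_cast
    rfl
  rw [he] at h
  exact_mod_cast h

/-- The partial Fourier sum over the frequencies in `s`. -/
def fourierSum (u : T d → ℂ) (s : Finset (Fin d → ℤ)) (x : T d) : ℂ :=
  ∑ k ∈ s, fc u k * mFourier k x

theorem contDiff_fourierSum {n : WithTop ℕ∞} (u : T d → ℂ) (s : Finset (Fin d → ℤ)) :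
    ContDiff ℝ n fun y => fourierSum u s (proj d y) :=
  ContDiff.sum fun k _ => contDiff_const.mul (contDiff_mFourier k)

theorem continuous_fourierSum (u : T d → ℂ) (s : Finset (Fin d → ℤ)) :
    Continuous (fourierSum u s) := by
  unfold fourierSum; fun_prop

theorem torusDeriv_fourierSum (u : T d → ℂ) (s : Finset (Fin d → ℤ)) (j : Fin d) (x : T d) :
    torusDeriv j (fourierSum u s) x =
      ∑ k ∈ s, 2 * Real.pi * Complex.I * k j * fc u k * mFourier k x := by
  have h : HasDerivAt (fun t : ℝ => fourierSum u s (x + Pi.single j (t : UnitAddCircle)))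
      (∑ k ∈ s, fc u k * torusDeriv j (mFourier k) (x + Pi.single j ((0 : ℝ) : UnitAddCircle))) 0 :=
    HasDerivAt.fun_sum fun k _ => (hasDerivAt_torusDeriv (contDiff_mFourier k) x j 0).const_mul _
  rw [torusDeriv, h.deriv]
  refine Finset.sum_congr rfl fun k _ => ?_
  rw [torusDeriv_mFourier]
  simp
  ring

theorem tendsto_eLpNorm_fourierSum_sub (hu : MemLp u 2 (leb d)) :
    Tendsto (fun s => eLpNorm (fourierSum u s - u) 2 (leb d)) atTop (𝓝 0) := by
  set b : (Fin d → ℤ) → Lp ℂ 2 (leb d) := fun k =>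
    ContinuousMap.toLp (E := ℂ) 2 (leb d) ℂ (mFourier k)
  have h : HasSum (fun k => fc (hu.toLp u) k • b k) (hu.toLp u) := UnitAddTorus.hasSum_mFourier_series_L2 (hu.toLp u)
  have h' := (Lp.tendsto_Lp_iff_tendsto_eLpNorm _ u hu).1 h
  refine h'.congr fun s => eLpNorm_congr_ae ?_
  refine EventuallyEq.sub ?_ EventuallyEq.rfl
  refine (Lp.coeFn_finsetSum (μ := leb d) s _).trans ?_
  have : ∀ k ∈ s, ⇑(fc (hu.toLp u) k • b k) =ᵐ[leb d] fun x => fc u k * mFourier k x := by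
    intro k _
    filter_upwards [Lp.coeFn_smul (fc (hu.toLp u) k) (b k),
      ContinuousMap.coeFn_toLp (𝕜 := ℂ) (p := 2) (leb d) (mFourier k)] with x h1 h2
    rw [h1, Pi.smul_apply, h2, smul_eq_mul, fc_congr_ae hu.coeFn_toLp]
  filter_upwards [(Finset.eventually_all s).2 this] with x hx
  rw [Finset.sum_apply]
  exact Finset.sum_congr rfl hx

end Fourier

/-! ### Toral automorphisms -/

section ToralMap

open UnitAddTorus Matrix

variable {d : ℕ}

theorem toralMap_mul (A B : Matrix (Fin d) (Fin d) ℤ) (x : T d) :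
    toralMap (A * B) x = toralMap A (toralMap B x) := by
  funext i
  simp only [toralMap, Matrix.mul_apply, Finset.sum_smul, Finset.smul_sum, mul_smul]
  exact Finset.sum_comm

theorem toralMap_one (x : T d) : toralMap 1 x = x := by
  funext i
  simp [toralMap, Matrix.one_apply, ite_smul]

theorem toralMap_proj (A : Matrix (Fin d) (Fin d) ℤ) (y : Fin d → ℝ) :
    toralMap A (proj d y) = proj d fun i => ∑ j, (A i j : ℝ) * y j := by
  funext i
  have : ((∑ j, (A i j : ℝ) * y j : ℝ) : UnitAddCircle) =
      ∑ j, (((A i j : ℝ) * y j : ℝ) : UnitAddCircle) :=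
    map_sum (QuotientAddGroup.mk' (AddSubgroup.zmultiples (1 : ℝ))) _ _
  simp only [toralMap, proj, this]
  refine Finset.sum_congr rfl fun j _ => ?_
  rw [← zsmul_eq_mul, AddCircle.coe_zsmul]

theorem mapContDiff_toralMap {n : WithTop ℕ∞} (A : Matrix (Fin d) (Fin d) ℤ) :
    MapContDiff n (toralMap A) :=
  ⟨_, by fun_prop, toralMap_proj A⟩

/-- The automorphism of the torus given by a matrix in `SL(d, ℤ)`. -/
def toralEquiv (A : Matrix.SpecialLinearGroup (Fin d) ℤ) : T d ≃ T d where
  toFun := toralMap A.1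
  invFun := toralMap A⁻¹.1
  left_inv x := by
    rw [← toralMap_mul, ← Matrix.SpecialLinearGroup.coe_mul, inv_mul_cancel]
    exact toralMap_one x
  right_inv x := by
    rw [← toralMap_mul, ← Matrix.SpecialLinearGroup.coe_mul, mul_inv_cancel]
    exact toralMap_one x

theorem isDiffeo_toralEquiv {n : WithTop ℕ∞} (A : Matrix.SpecialLinearGroup (Fin d) ℤ) :
    IsDiffeo n (toralEquiv A) :=
  ⟨mapContDiff_toralMap _, mapContDiff_toralMap _⟩

theorem IsDiffeo.measurableEmbedding {n : WithTop ℕ∞} {Φ : T d ≃ T d} (h : IsDiffeo n Φ) :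
    MeasurableEmbedding Φ :=
  (Homeomorph.mk Φ h.1.continuous h.2.continuous).measurableEmbedding

theorem IsDiffeo.measurePreserving_symm {n : WithTop ℕ∞} {Φ : T d ≃ T d} (h : IsDiffeo n Φ)
    {μ ν : Measure (T d)} (hm : MeasurePreserving Φ μ ν) : MeasurePreserving Φ.symm ν μ := by
  refine ⟨h.2.continuous.measurable, ?_⟩
  rw [← hm.map_eq, Measure.map_map h.2.continuous.measurable h.1.continuous.measurable]
  simp

theorem measurePreserving_toralEquiv (A : Matrix.SpecialLinearGroup (Fin d) ℤ) :
    MeasurePreserving (toralEquiv A) (leb d) (leb d) := by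
  set φ : T d →+ T d :=
    { toFun := toralMap A.1
      map_zero' := by funext i; simp [toralMap]
      map_add' := fun x y => by funext i; simp [toralMap, Finset.sum_add_distrib] }
  exact AddMonoidHom.measurePreserving (f := φ) (mapContDiff_toralMap (n := 0) A.1).continuous
    (toralEquiv A).surjective (by simp)

theorem mFourier_toralMap (A : Matrix (Fin d) (Fin d) ℤ) (k : Fin d → ℤ) (x : T d) :
    mFourier k (toralMap A x) = mFourier (Aᵀ *ᵥ k) x := by
  obtain ⟨y, rfl⟩ := proj_surjective d x
  rw [toralMap_proj, mFourier_proj, mFourier_proj, ← Complex.exp_sum, ← Complex.exp_sum]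
  congr 1
  simp only [Matrix.mulVec, dotProduct, Matrix.transpose_apply]
  push_cast
  simp only [Finset.mul_sum, Finset.sum_mul]
  rw [Finset.sum_comm]
  exact Finset.sum_congr rfl fun i _ => Finset.sum_congr rfl fun j _ => by ring

theorem fc_comp_toralMap (A : Matrix.SpecialLinearGroup (Fin d) ℤ) (u : T d → ℂ)
    (k : Fin d → ℤ) : fc (fun x => u (toralMap A.1 x)) (A.1ᵀ *ᵥ k) = fc u k := by
  refine Eq.trans ?_ ((measurePreserving_toralEquiv A).integral_comp
    (isDiffeo_toralEquiv (n := 0) A).measurableEmbedding fun x => mFourier (-k) x * u x)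
  refine integral_congr_ae (Filter.Eventually.of_forall fun x => ?_)
  simp only [toralEquiv, Equiv.coe_fn_mk]
  rw [mFourier_toralMap, Matrix.mulVec_neg]

theorem fc_comp_toralMap_iterate (A : Matrix.SpecialLinearGroup (Fin d) ℤ) (u : T d → ℂ)
    (k : Fin d → ℤ) (n : ℕ) :
    fc (fun x => u ((toralMap A.1)^[n] x)) ((A.1ᵀ *ᵥ ·)^[n] k) = fc u k := by
  induction n with
  | zero => rfl
  | succ n ih =>
    rw [Function.iterate_succ_apply', ← ih,
      ← fc_comp_toralMap A (fun x => u ((toralMap A.1)^[n] x))]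
    rfl

theorem bijective_transpose_mulVec (A : Matrix.SpecialLinearGroup (Fin d) ℤ) :
    Function.Bijective fun k : Fin d → ℤ => A.1ᵀ *ᵥ k := by
  refine Function.bijective_iff_has_inverse.2 ⟨fun k => A⁻¹.1ᵀ *ᵥ k, fun k => ?_, fun k => ?_⟩
  · simp only [Matrix.mulVec_mulVec, ← Matrix.transpose_mul]
    rw [← Matrix.SpecialLinearGroup.coe_mul, mul_inv_cancel]
    simp
  · simp only [Matrix.mulVec_mulVec, ← Matrix.transpose_mul]
    rw [← Matrix.SpecialLinearGroup.coe_mul, inv_mul_cancel]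
    simp

end ToralMap

/-! ### Sobolev functions under a change of variables -/

section Sobolev

open UnitAddTorus Filter Topology
open scoped ComplexConjugate

variable {d : ℕ}

theorem integral_ofReal_mul {h : T d → ℝ} {E : T d → ℂ} (hh : Integrable h (leb d))
    (hE : Continuous E) : ∫ x, (h x : ℂ) * E x ∂leb d =
      (∫ x, h x * (E x).re ∂leb d : ℝ) + (∫ x, h x * (E x).im ∂leb d : ℝ) * Complex.I := by
  obtain ⟨C, hC⟩ := isCompact_univ.exists_bound_of_continuousOn hE.continuousOn
  have hint : Integrable (fun x => (h x : ℂ) * E x) (leb d) :=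
    hh.ofReal.mul_bdd (c := C) hE.aestronglyMeasurable (ae_of_all _ fun x => hC x trivial)
  rw [← integral_re_add_im hint]
  simp

/-- The Fourier coefficients of a weak gradient. -/
theorem fc_weakGrad {f : T d → ℝ} {G : T d → EuclideanSpace ℝ (Fin d)} {j : Fin d}
    (hf : Integrable f (leb d)) (hG : Integrable (fun x => G x j) (leb d)) (h : IsWeakGrad f G)
    (k : Fin d → ℤ) :
    fc (fun x => (G x j : ℂ)) k = 2 * Real.pi * Complex.I * k j * fc (fun x => (f x : ℂ)) k := by
  have hE := contDiff_mFourier (d := d) (n := ∞) (-k)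
  have hd := fun x => hasDerivAt_torusDeriv (contDiff_mFourier (-k)) x j 0
  have hre : ∀ x, partialDeriv j (fun x => (mFourier (-k) x).re) x =
      (torusDeriv j (mFourier (-k)) x).re := fun x => by
    have := Complex.reCLM.hasFDerivAt.comp_hasDerivAt 0 (hd x)
    exact this.deriv.trans (by simp)
  have him : ∀ x, partialDeriv j (fun x => (mFourier (-k) x).im) x =
      (torusDeriv j (mFourier (-k)) x).im := fun x => by
    have := Complex.imCLM.hasFDerivAt.comp_hasDerivAt 0 (hd x)
    exact this.deriv.trans (by simp)
  have h1 := h (fun x => (mFourier (-k) x).re) (Complex.reCLM.contDiff.comp hE) j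
  have h2 := h (fun x => (mFourier (-k) x).im) (Complex.imCLM.contDiff.comp hE) j
  simp_rw [hre] at h1
  simp_rw [him] at h2
  have key : ∫ x, (f x : ℂ) * torusDeriv j (mFourier (-k)) x ∂leb d =
      -∫ x, (G x j : ℂ) * mFourier (-k) x ∂leb d := by
    rw [integral_ofReal_mul hf (continuous_torusDeriv (contDiff_mFourier (-k)) j),
      integral_ofReal_mul hG (by fun_prop), h1, h2]
    push_cast
    ring
  have e1 : ∫ x, (f x : ℂ) * torusDeriv j (mFourier (-k)) x ∂leb d =
      2 * Real.pi * Complex.I * ((-k) j : ℤ) * fc (fun x => (f x : ℂ)) k := by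
    rw [fc, ← integral_const_mul]
    refine integral_congr_ae (ae_of_all _ fun x => ?_)
    simp only [torusDeriv_mFourier]
    ring
  have e2 : ∫ x, (G x j : ℂ) * mFourier (-k) x ∂leb d = fc (fun x => (G x j : ℂ)) k := by
    rw [fc]
    exact integral_congr_ae (ae_of_all _ fun x => mul_comm _ _)
  rw [e1, e2] at key
  rw [← neg_neg (fc (fun x => (G x j : ℂ)) k), ← key]
  push_cast [Pi.neg_apply]
  ring

/-- The transposed Jacobian of the lift `F` of a torus map multiplies squared lengths by at most `L`,
at some representative of each point; one representative suffices because the gradients to which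
the bound is applied are functions on the torus. The vectors are complex, as gradients of
trigonometric polynomials are. -/
def JacobianBound (L : ℝ) (F : (Fin d → ℝ) → (Fin d → ℝ)) : Prop :=
  ∀ x : T d, ∃ y, proj d y = x ∧ ∀ ξ : Fin d → ℂ,
    ∑ j, ‖∑ i, ((fderiv ℝ F y (Pi.single j 1) i : ℝ) : ℂ) * ξ i‖ ^ 2 ≤ L * ∑ i, ‖ξ i‖ ^ 2

theorem norm_two_pi_I_mul_sq (m : ℤ) (z : ℂ) :
    ‖2 * Real.pi * Complex.I * m * z‖ ^ 2 = 4 * Real.pi ^ 2 * ((m : ℝ) ^ 2 * ‖z‖ ^ 2) := by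
  simp only [norm_mul, Complex.norm_I, Complex.norm_real, Real.norm_eq_abs, mul_pow, sq_abs,
    Complex.norm_intCast, Complex.norm_ofNat]
  ring

variable {μ : Measure (T d)} {ψ : T d ≃ T d} {F : (Fin d → ℝ) → (Fin d → ℝ)} {L : ℝ}

theorem sum_norm_torusDeriv_comp_le {u : T d → ℂ} (hu : ContDiff ℝ 1 fun y => u (proj d y))
    (hF : ContDiff ℝ 1 F) (hψF : ∀ y, ψ.symm (proj d y) = proj d (F y)) (hL : JacobianBound L F)
    (x : T d) : ∑ j, ‖torusDeriv j (fun x => u (ψ.symm x)) x‖ ^ 2 ≤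
      L * ∑ i, ‖torusDeriv i u (ψ.symm x)‖ ^ 2 := by
  obtain ⟨y, rfl, hy⟩ := hL x
  refine le_of_eq_of_le ?_ (hy fun i => torusDeriv i u (ψ.symm (proj d y)))
  refine Finset.sum_congr rfl fun j _ => ?_
  have hw : (fun y => u (ψ.symm (proj d y))) = (fun y => u (proj d y)) ∘ F :=
    funext fun y => by simp [hψF]
  have hwc : ContDiff ℝ 1 fun y => u (ψ.symm (proj d y)) := by rw [hw]; exact hu.comp hF
  rw [torusDeriv_proj (u := fun x => u (ψ.symm x)) hwc, hw,
    fderiv_comp _ (hu.differentiable one_ne_zero).differentiableAt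
      (hF.differentiable one_ne_zero).differentiableAt]
  simp_rw [hψF, torusDeriv_proj hu]
  congr 2
  set v := fderiv ℝ F y (Pi.single j 1)
  rw [ContinuousLinearMap.comp_apply]
  conv_lhs => rw [show fderiv ℝ F y (Pi.single j 1) = v from rfl, pi_eq_sum_univ' v]
  rw [map_sum]
  refine Finset.sum_congr rfl fun i _ => ?_
  rw [map_smul, Complex.real_smul]

theorem sum_norm_fc_comp_le_of_contDiff (hψ : IsDiffeo 2 ψ) (hm : MeasurePreserving ψ μ (leb d))
    (hF : ContDiff ℝ 1 F) (hψF : ∀ y, ψ.symm (proj d y) = proj d (F y)) (hL : JacobianBound L F)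
    {u : T d → ℂ} (hu : ContDiff ℝ 1 fun y => u (proj d y)) (s : Finset (Fin d → ℤ)) :
    4 * Real.pi ^ 2 * ∑ k ∈ s, (∑ j, (k j : ℝ) ^ 2) * ‖fc (fun x => u (ψ.symm x)) k‖ ^ 2 ≤
      L * ∫ x, ∑ j, ‖torusDeriv j u x‖ ^ 2 ∂μ := by
  set w : T d → ℂ := fun x => u (ψ.symm x)
  have hwc : ContDiff ℝ 1 fun y => w (proj d y) := by
    simp only [w, hψF]; exact hu.comp hF
  have hdw := fun j => continuous_torusDeriv hwc j
  have hdu := fun j => continuous_torusDeriv hu j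
  have hψc := hψ.2.continuous
  calc 4 * Real.pi ^ 2 * ∑ k ∈ s, (∑ j, (k j : ℝ) ^ 2) * ‖fc w k‖ ^ 2
      = ∑ j, ∑ k ∈ s, ‖fc (torusDeriv j w) k‖ ^ 2 := by
        simp_rw [fc_torusDeriv hwc, norm_two_pi_I_mul_sq]
        rw [Finset.sum_comm, Finset.mul_sum]
        simp_rw [Finset.sum_mul, Finset.mul_sum]
    _ ≤ ∑ j, ∫ x, ‖torusDeriv j w x‖ ^ 2 ∂leb d := Finset.sum_le_sum fun j _ =>
        sum_le_hasSum s (fun k _ => sq_nonneg _)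
          (hasSum_norm_fc_sq (memLp_of_continuous (hdw j) _))
    _ = ∫ x, ∑ j, ‖torusDeriv j w x‖ ^ 2 ∂leb d :=
        (integral_finsetSum _ fun j _ =>
          integrable_of_continuous ((hdw j).norm.pow 2) _).symm
    _ ≤ ∫ x, L * ∑ i, ‖torusDeriv i u (ψ.symm x)‖ ^ 2 ∂leb d := by
        refine integral_mono (integrable_of_continuous ?_ _) (integrable_of_continuous ?_ _)
          fun x => sum_norm_torusDeriv_comp_le hu hF hψF hL x
        · exact continuous_finsetSum _ fun j _ => (hdw j).norm.pow 2
        · exact continuous_const.mul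
            (continuous_finsetSum _ fun j _ => ((hdu j).comp hψc).norm.pow 2)
    _ = L * ∫ x, ∑ j, ‖torusDeriv j u x‖ ^ 2 ∂μ := by
        rw [integral_const_mul, ← hm.integral_comp hψ.measurableEmbedding]
        simp

end Sobolev

/-! ### Passage to weakly differentiable functions -/

section Limit

open UnitAddTorus Filter Topology
open scoped ComplexConjugate

variable {d : ℕ}

theorem integral_norm_sq_eq {μ : Measure (T d)} {f : T d → ℂ} (hf : MemLp f 2 μ) :
    ∫ x, ‖f x‖ ^ 2 ∂μ = ‖hf.toLp f‖ ^ 2 := by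
  have h0 : 0 ≤ ∫ x, ‖f x‖ ^ 2 ∂μ := integral_nonneg fun x => sq_nonneg _
  rw [Lp.norm_toLp, hf.eLpNorm_eq_integral_rpow_norm two_ne_zero ENNReal.ofNat_ne_top,
    ENNReal.toReal_ofReal (by positivity)]
  simp only [ENNReal.toReal_ofNat, Real.rpow_ofNat]
  rw [← Real.rpow_natCast, ← Real.rpow_mul h0]
  norm_num

theorem tendsto_integral_norm_sq {μ : Measure (T d)} {ι : Type*} {l : Filter ι}
    {f : ι → T d → ℂ} {g : T d → ℂ} (hf : ∀ s, MemLp (f s) 2 μ) (hg : MemLp g 2 μ)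
    (h : Tendsto (fun s => eLpNorm (f s - g) 2 μ) l (𝓝 0)) :
    Tendsto (fun s => ∫ x, ‖f s x‖ ^ 2 ∂μ) l (𝓝 (∫ x, ‖g x‖ ^ 2 ∂μ)) := by
  simp_rw [integral_norm_sq_eq (hf _), integral_norm_sq_eq hg]
  exact (((Lp.tendsto_Lp_iff_tendsto_eLpNorm'' f hf g hg).2 h).norm).pow 2

variable {ψ : T d ≃ T d} {F : (Fin d → ℝ) → (Fin d → ℝ)} {L : ℝ} {U : T d → ℝ} {κ : ℝ}

/-- The bound `‖∇(f ∘ ψ⁻¹)‖² ≤ L ‖∇f‖²` for `f ∈ Ḣ¹(μ)`, expressed through Fourier coefficients.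
It passes from trigonometric polynomials to `f` because the partial Fourier sums of `f` converge to
`f` together with their gradients. -/
theorem sum_norm_fc_comp_le (hU : Continuous U) (hψ : IsDiffeo 2 ψ)
    (hm : MeasurePreserving ψ (gibbs U κ) (leb d)) (hF : ContDiff ℝ 1 F)
    (hψF : ∀ y, ψ.symm (proj d y) = proj d (F y)) (hL : JacobianBound L F)
    {f : T d → ℝ} {G : T d → EuclideanSpace ℝ (Fin d)} (hf : InHDot1 U κ f G)
    (s : Finset (Fin d → ℤ)) :
    4 * Real.pi ^ 2 * ∑ k ∈ s, (∑ j, (k j : ℝ) ^ 2) *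
      ‖fc (fun x => (f (ψ.symm x) : ℂ)) k‖ ^ 2 ≤ L * ∫ x, ‖G x‖ ^ 2 ∂gibbs U κ := by
  have := isProbabilityMeasure_gibbs (κ := κ) hU
  obtain ⟨C, hC, hle, hge⟩ := exists_leb_le_gibbs_le hU κ
  set μ := gibbs U κ
  have hGj : ∀ j, MemLp (fun x => G x j) 2 μ := fun j =>
    hf.memLp_grad.of_le ((EuclideanSpace.proj (𝕜 := ℝ) j).continuous.comp_aestronglyMeasurable
      hf.memLp_grad.1) (ae_of_all _ fun x => PiLp.norm_apply_le (G x) j)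
  set fC : T d → ℂ := fun x => f x
  set GC : Fin d → T d → ℂ := fun j x => G x j
  have hfμ : MemLp fC 2 μ := hf.memLp.ofReal
  have hGμ : ∀ j, MemLp (GC j) 2 μ := fun j => (hGj j).ofReal
  have hfl : MemLp fC 2 (leb d) := hfμ.of_measure_le_smul hC hle
  have hGl : ∀ j, MemLp (GC j) 2 (leb d) := fun j => (hGμ j).of_measure_le_smul hC hle
  have hlim : ∀ u : T d → ℂ, MemLp u 2 (leb d) →
      Tendsto (fun t => eLpNorm (fourierSum u t - u) 2 μ) atTop (𝓝 0) := by
    intro u hu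
    have h1 : Tendsto (fun t => C ^ (1 / (2 : ENNReal)).toReal •
        eLpNorm (fourierSum u t - u) 2 (leb d)) atTop (𝓝 0) := by
      have := ENNReal.Tendsto.const_mul (a := C ^ (1 / (2 : ENNReal)).toReal)
        (tendsto_eLpNorm_fourierSum_sub hu)
        (Or.inr (ENNReal.rpow_ne_top_of_nonneg ENNReal.toReal_nonneg hC))
      simpa using this
    exact tendsto_of_tendsto_of_tendsto_of_le_of_le tendsto_const_nhds h1 (fun _ => zero_le)
      fun t => eLpNorm_le_of_measure_le_smul hge
  have hgrad : ∀ t j x, torusDeriv j (fourierSum fC t) x = fourierSum (GC j) t x := by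
    intro t j x
    rw [torusDeriv_fourierSum, fourierSum]
    refine Finset.sum_congr rfl fun k _ => ?_
    rw [fc_weakGrad ((hf.memLp.of_measure_le_smul hC hle).integrable one_le_two)
      (((hGj j).of_measure_le_smul hC hle).integrable one_le_two) hf.weakGrad]
  have hmem : ∀ u t, MemLp (fourierSum u t) 2 μ := fun u t =>
    memLp_of_continuous (continuous_fourierSum u t) μ
  have hineq := fun t => sum_norm_fc_comp_le_of_contDiff hψ hm hF hψF hL
    (contDiff_fourierSum fC t) s
  simp_rw [hgrad] at hineq
  have hnorm : ∫ x, ‖G x‖ ^ 2 ∂μ = ∑ j, ∫ x, ‖GC j x‖ ^ 2 ∂μ := by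
    rw [← integral_finsetSum _ fun j _ => (hGμ j).integrable_norm_pow two_ne_zero]
    refine integral_congr_ae (ae_of_all _ fun x => ?_)
    simp [EuclideanSpace.norm_sq_eq, GC]
  have hRHS : Tendsto (fun t => L * ∫ x, ∑ j, ‖fourierSum (GC j) t x‖ ^ 2 ∂μ) atTop
      (𝓝 (L * ∫ x, ‖G x‖ ^ 2 ∂μ)) := by
    rw [hnorm]
    refine Tendsto.const_mul _ ?_
    have : ∀ t, ∫ x, ∑ j, ‖fourierSum (GC j) t x‖ ^ 2 ∂μ =
        ∑ j, ∫ x, ‖fourierSum (GC j) t x‖ ^ 2 ∂μ := fun t =>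
      integral_finsetSum _ fun j _ => (hmem _ t).integrable_norm_pow two_ne_zero
    simp_rw [this]
    exact tendsto_finsetSum _ fun j _ =>
      tendsto_integral_norm_sq (hmem _) (hGμ j) (hlim _ (hGl j))
  have hfc : ∀ (u : T d → ℂ) k, fc (fun x => u (ψ.symm x)) k =
      ∫ x, mFourier (-k) (ψ x) * u x ∂μ := by
    intro u k
    rw [fc, ← hm.integral_comp hψ.measurableEmbedding]
    simp
  have hψc := hψ.1.continuous
  have hLHS : ∀ k, Tendsto (fun t => fc (fun x => fourierSum fC t (ψ.symm x)) k) atTop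
      (𝓝 (fc (fun x => fC (ψ.symm x)) k)) := by
    intro k
    simp_rw [hfc]
    have hck : Continuous fun x => mFourier (-k) (ψ x) := by fun_prop
    refine tendsto_integral_of_L1' _ (hck.aestronglyMeasurable.mul hfμ.1)
      (Eventually.of_forall fun t => integrable_of_continuous
        (hck.mul (continuous_fourierSum fC t)) μ) ?_
    refine tendsto_of_tendsto_of_tendsto_of_le_of_le tendsto_const_nhds (hlim fC hfl)
      (fun _ => zero_le) fun t => ?_
    calc _ = eLpNorm (fourierSum fC t - fC) 1 μ := by
          refine eLpNorm_congr_norm_ae (ae_of_all _ fun x => ?_)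
          simp only [Pi.sub_apply, Pi.mul_apply]
          rw [← mul_sub, norm_mul, norm_mFourier_apply, one_mul]
      _ ≤ _ := eLpNorm_le_eLpNorm_of_exponent_le one_le_two ((hmem fC t).1.sub hfμ.1)
  refine le_of_tendsto_of_tendsto' (Tendsto.const_mul _ ?_) hRHS hineq
  exact tendsto_finsetSum _ fun k _ => ((hLHS k).norm.pow 2).const_mul _

/-! ### Decay of correlations -/

/-- Decay of correlations under a toral automorphism: composition with the `n`-th iterate moves
the coefficient at `k` to `Bⁿ k`, `B` the transposed matrix, and `|k| |Bⁿ k|` is large. -/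
theorem norm_integral_conj_mul_comp_le {A : Matrix.SpecialLinearGroup (Fin d) ℤ} {c r : ℝ}
    (hA : Expands c r A.1.transpose) (hc : 0 < c) (hr : 0 < r) {u v : T d → ℂ}
    (hu : MemLp u 2 (leb d)) (hv : MemLp v 2 (leb d)) (hu0 : fc u 0 = 0) {P Q : ℝ}
    (hP : ∀ s : Finset (Fin d → ℤ), ∑ k ∈ s, (∑ j, (k j : ℝ) ^ 2) * ‖fc u k‖ ^ 2 ≤ P)
    (hQ : ∀ s : Finset (Fin d → ℤ), ∑ k ∈ s, (∑ j, (k j : ℝ) ^ 2) * ‖fc v k‖ ^ 2 ≤ Q) (n : ℕ) :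
    ‖∫ x, conj (v x) * u ((toralMap A.1)^[n] x) ∂leb d‖ ≤
      (Real.sqrt (c * r ^ n))⁻¹ * (Real.sqrt P * Real.sqrt Q) := by
  set B : (Fin d → ℤ) → (Fin d → ℤ) := (A.1.transpose.mulVec ·)^[n]
  have hB : Function.Bijective B := (bijective_transpose_mulVec A).iterate n
  have hmp : MeasurePreserving ((toralMap A.1)^[n]) (leb d) (leb d) :=
    (measurePreserving_toralEquiv A).iterate n
  have hcomp : MemLp (fun x => u ((toralMap A.1)^[n] x)) 2 (leb d) :=
    hu.comp_measurePreserving hmp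
  have hsum := hasSum_conj_fc_mul_fc hv hcomp
  -- `B` permutes the frequencies, so Parseval's sum may be indexed by `B k`.
  rw [← (Equiv.ofBijective B hB).hasSum_iff] at hsum
  have hterm : ((fun k => conj (fc v k) * fc (fun x => u ((toralMap A.1)^[n] x)) k) ∘
      Equiv.ofBijective B hB) = fun k => conj (fc v (B k)) * fc u k := by
    funext k
    simp only [Function.comp_apply, Equiv.ofBijective_apply]
    rw [fc_comp_toralMap_iterate A u k n]
  rw [hterm] at hsum
  have hpos : 0 < c * r ^ n := by positivity
  refine le_of_tendsto (hsum.norm) (Eventually.of_forall fun s => ?_)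
  set N : (Fin d → ℤ) → ℝ := fun k => ∑ j, (k j : ℝ) ^ 2
  have hN : ∀ k, 0 ≤ N k := fun k => Finset.sum_nonneg fun j _ => sq_nonneg _
  have hbd : ∀ k, ‖conj (fc v (B k)) * fc u k‖ ≤ (Real.sqrt (c * r ^ n))⁻¹ *
      ((Real.sqrt (N k) * ‖fc u k‖) * (Real.sqrt (N (B k)) * ‖fc v (B k)‖)) := by
    intro k
    rw [norm_mul, RCLike.norm_conj]
    rcases eq_or_ne k 0 with rfl | hk
    · simp [hu0]
    have h1 : Real.sqrt (c * r ^ n) ≤ Real.sqrt (N k) * Real.sqrt (N (B k)) := by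
      rw [← Real.sqrt_mul (hN k)]
      exact Real.sqrt_le_sqrt (hA k hk n)
    rw [inv_mul_eq_div, le_div_iff₀ (Real.sqrt_pos.2 hpos)]
    calc ‖fc v (B k)‖ * ‖fc u k‖ * Real.sqrt (c * r ^ n)
        ≤ ‖fc v (B k)‖ * ‖fc u k‖ * (Real.sqrt (N k) * Real.sqrt (N (B k))) := by gcongr
      _ = _ := by ring
  have hsq : ∀ (w : T d → ℂ) k, (Real.sqrt (N k) * ‖fc w k‖) ^ 2 = N k * ‖fc w k‖ ^ 2 :=
    fun w k => by rw [mul_pow, Real.sq_sqrt (hN k)]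
  calc ‖∑ k ∈ s, conj (fc v (B k)) * fc u k‖
      ≤ ∑ k ∈ s, (Real.sqrt (c * r ^ n))⁻¹ *
        ((Real.sqrt (N k) * ‖fc u k‖) * (Real.sqrt (N (B k)) * ‖fc v (B k)‖)) :=
        (norm_sum_le _ _).trans (Finset.sum_le_sum fun k _ => hbd k)
    _ ≤ (Real.sqrt (c * r ^ n))⁻¹ * (Real.sqrt P * Real.sqrt Q) := by
        rw [← Finset.mul_sum]
        gcongr
        refine (Real.sum_mul_le_sqrt_mul_sqrt s _ _).trans ?_
        simp_rw [hsq]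
        gcongr
        · exact hP s
        · refine le_of_eq_of_le ?_ (hQ (s.map ⟨B, hB.1⟩))
          rw [Finset.sum_map]
          rfl

/-- The conjugate of a toral automorphism by a transport of the Gibbs measure to Lebesgue measure
is mixing, with a constant proportional to the squared Lipschitz bound of the inverse transport. -/
theorem mixesWithRate_conj {A : Matrix.SpecialLinearGroup (Fin d) ℤ} {c r : ℝ}
    (hA : Expands c r A.1.transpose) (hc : 0 < c) (hr : 0 < r) (hU : Continuous U)
    (hψ : IsDiffeo 2 ψ) (hm : MeasurePreserving ψ (gibbs U κ) (leb d)) (hF : ContDiff ℝ 1 F)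
    (hψF : ∀ y, ψ.symm (proj d y) = proj d (F y)) (hL : JacobianBound L F) (hL0 : 0 ≤ L)
    {Φ : T d → T d} (hΦ : ∀ x, Φ x = ψ.symm (toralMap A.1 (ψ x))) :
    MixesWithRate U κ Φ fun n =>
      L / (4 * Real.pi ^ 2 * Real.sqrt c) * Real.exp (-(Real.log r / 2) * n) := by
  have := isProbabilityMeasure_gibbs (κ := κ) hU
  intro f g Gf Gg hf hg n
  have hiter : ∀ x, ψ (Φ^[n] x) = (toralMap A.1)^[n] (ψ x) :=
    (Function.Semiconj.iterate_right (f := ψ) (fun x => by simp [hΦ]) n)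
  have hπ : (0 : ℝ) < 4 * Real.pi ^ 2 := by positivity
  have hmsymm := hψ.measurePreserving_symm hm
  have hmem : ∀ {f : T d → ℝ} {G}, InHDot1 U κ f G →
      MemLp (fun x => (f (ψ.symm x) : ℂ)) 2 (leb d) := fun h =>
    (h.memLp.comp_measurePreserving hmsymm).ofReal
  have hsum : ∀ {f : T d → ℝ} {G}, InHDot1 U κ f G → ∀ s : Finset (Fin d → ℤ),
      ∑ k ∈ s, (∑ j, (k j : ℝ) ^ 2) * ‖fc (fun x => (f (ψ.symm x) : ℂ)) k‖ ^ 2 ≤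
        L / (4 * Real.pi ^ 2) * ∫ x, ‖G x‖ ^ 2 ∂gibbs U κ := fun h s => by
    rw [div_mul_eq_mul_div, le_div_iff₀ hπ, mul_comm]
    exact sum_norm_fc_comp_le hU hψ hm hF hψF hL h s
  have h0 : fc (fun x => (f (ψ.symm x) : ℂ)) 0 = 0 := by
    have h1 : ∫ x, f (ψ.symm x) ∂leb d = 0 := by
      rw [← hf.mean_zero, ← hm.integral_comp hψ.measurableEmbedding]
      simp
    have h2 : fc (fun x => (f (ψ.symm x) : ℂ)) 0 = ((∫ x, f (ψ.symm x) ∂leb d : ℝ) : ℂ) := by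
      rw [fc, ← integral_complex_ofReal]
      simp [mFourier_zero]
    rw [h2, h1, Complex.ofReal_zero]
  have key := norm_integral_conj_mul_comp_le hA hc hr (hmem hf) (hmem hg) h0 (hsum hf) (hsum hg) n
  have hint : ∫ x, conj ((g (ψ.symm x) : ℝ) : ℂ) *
      ((f (ψ.symm ((toralMap A.1)^[n] x)) : ℝ) : ℂ) ∂leb d =
      ((∫ x, f (Φ^[n] x) * g x ∂gibbs U κ : ℝ) : ℂ) := by
    rw [← integral_complex_ofReal, ← hm.integral_comp hψ.measurableEmbedding]
    refine integral_congr_ae (ae_of_all _ fun x => ?_)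
    simp only [Equiv.symm_apply_apply, ← hiter, Complex.conj_ofReal]
    push_cast
    ring
  rw [hint, Complex.norm_real, Real.norm_eq_abs] at key
  refine key.trans_eq ?_
  beta_reduce
  have hexp : Real.exp (-(Real.log r / 2) * n) = (Real.sqrt (r ^ n))⁻¹ := by
    rw [← Real.exp_log (Real.sqrt_pos.2 (pow_pos hr n)), ← Real.exp_neg,
      Real.log_sqrt (pow_pos hr n).le, Real.log_pow]
    congr 1
    ring
  have hL1 : 0 ≤ L / (4 * Real.pi ^ 2) := by positivity
  rw [hexp, hDot1Norm, hDot1Norm, Real.sqrt_mul hL1, Real.sqrt_mul hL1, Real.sqrt_mul hc.le]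
  have hs := Real.mul_self_sqrt hL1
  calc _ = (Real.sqrt (L / (4 * Real.pi ^ 2)) * Real.sqrt (L / (4 * Real.pi ^ 2))) *
        (Real.sqrt c)⁻¹ * (Real.sqrt (r ^ n))⁻¹ * Real.sqrt (∫ x, ‖Gf x‖ ^ 2 ∂gibbs U κ) *
          Real.sqrt (∫ x, ‖Gg x‖ ^ 2 ∂gibbs U κ) := by rw [mul_inv]; ring
    _ = _ := by rw [hs, ← div_eq_mul_inv _ (Real.sqrt c), div_div]

theorem exists_jacobianBound (hF : ContDiff ℝ 1 F) : ∃ L : ℝ, 0 ≤ L ∧ JacobianBound L F := by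
  have hc : Continuous fun y => ∑ j, ∑ i, (fderiv ℝ F y (Pi.single j 1) i) ^ 2 :=
    continuous_finsetSum _ fun j _ => continuous_finsetSum _ fun i _ =>
      ((continuous_apply i).comp
        ((hF.continuous_fderiv one_ne_zero).clm_apply continuous_const)).pow 2
  obtain ⟨L, hL⟩ := (isCompact_Icc (a := (0 : Fin d → ℝ)) (b := 1)).exists_bound_of_continuousOn
    hc.continuousOn
  refine ⟨max L 0, le_max_right _ _, fun x => ?_⟩
  obtain ⟨y, hy, hyx⟩ := exists_mem_unitCube_proj_eq x
  refine ⟨y, hyx, fun ξ => ?_⟩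
  calc ∑ j, ‖∑ i, ((fderiv ℝ F y (Pi.single j 1) i : ℝ) : ℂ) * ξ i‖ ^ 2
      ≤ ∑ j, (∑ i, (fderiv ℝ F y (Pi.single j 1) i) ^ 2) * ∑ i, ‖ξ i‖ ^ 2 := by
        refine Finset.sum_le_sum fun j _ => ?_
        calc _ ≤ (∑ i, |fderiv ℝ F y (Pi.single j 1) i| * ‖ξ i‖) ^ 2 := by
              gcongr
              refine (norm_sum_le _ _).trans_eq (Finset.sum_congr rfl fun i _ => ?_)
              rw [norm_mul, Complex.norm_real, Real.norm_eq_abs]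
          _ ≤ _ := by
              refine (Finset.sum_mul_sq_le_sq_mul_sq _ _ _).trans_eq ?_
              simp_rw [sq_abs]
    _ = (∑ j, ∑ i, (fderiv ℝ F y (Pi.single j 1) i) ^ 2) * ∑ i, ‖ξ i‖ ^ 2 := by
        rw [Finset.sum_mul]
    _ ≤ _ := by
        refine mul_le_mul_of_nonneg_right ?_ (Finset.sum_nonneg fun i _ => sq_nonneg _)
        exact ((le_abs_self _).trans (hL y hy)).trans (le_max_left _ _)

theorem jacobianBound_diagonal {g : ℝ → ℝ} (hg : ContDiff ℝ 1 g) {K : ℝ}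
    (hK : ∀ t, |deriv g t| ≤ K) : JacobianBound (K ^ 2) fun (y : Fin d → ℝ) i => g (y i) := by
  intro x
  obtain ⟨y, rfl⟩ := proj_surjective d x
  refine ⟨y, rfl, fun ξ => ?_⟩
  have hder : ∀ i j, fderiv ℝ (fun (y : Fin d → ℝ) i => g (y i)) y (Pi.single j 1) i =
      if i = j then deriv g (y j) else 0 := by
    intro i j
    have h : HasFDerivAt (fun (y : Fin d → ℝ) i => g (y i)) (ContinuousLinearMap.pi fun i =>
        (deriv g (y i)) • ContinuousLinearMap.proj (R := ℝ) (φ := fun _ : Fin d => ℝ) i) y :=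
      hasFDerivAt_pi.2 fun i =>
        ((hg.differentiable one_ne_zero).differentiableAt.hasDerivAt (x := y i)).comp_hasFDerivAt y
          (hasFDerivAt_apply i y)
    rw [h.fderiv]
    rcases eq_or_ne i j with rfl | hij
    · simp
    · simp [hij]
  rw [Finset.mul_sum]
  refine Finset.sum_le_sum fun j _ => ?_
  simp only [hder, apply_ite (Complex.ofReal), Complex.ofReal_zero, ite_mul, zero_mul,
    Finset.sum_ite_eq', Finset.mem_univ, if_true]
  rw [norm_mul, Complex.norm_real, Real.norm_eq_abs, mul_pow]
  gcongr
  exact hK _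

/-! ### Admissible mixing constants -/

/-- `D` is admissible when some conjugate of the automorphism `A` by a transport of the Gibbs
measure to Lebesgue measure is mixing with rate `D e^{-γ n}`. -/
def IsMixingConstant (γ : ℝ) (A : Matrix.SpecialLinearGroup (Fin d) ℤ) (U : T d → ℝ) (κ D : ℝ) :
    Prop :=
  0 ≤ D ∧ ∃ Φ ψ : T d ≃ T d, IsDiffeo 2 Φ ∧ IsDiffeo 2 ψ ∧
    MeasurePreserving ψ (gibbs U κ) (leb d) ∧
    (∀ x, Φ x = ψ.symm (toralMap A.1 (ψ x))) ∧
    MeasurePreserving Φ (gibbs U κ) (gibbs U κ) ∧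
    MixesWithRate U κ Φ (fun n => D * Real.exp (-γ * n))

theorem IsMixingConstant.mono {γ D D' : ℝ} {A : Matrix.SpecialLinearGroup (Fin d) ℤ}
    (h : IsMixingConstant γ A U κ D) (hD : D ≤ D') : IsMixingConstant γ A U κ D' := by
  obtain ⟨h0, Φ, ψ, h1, h2, h3, h4, h5, h6⟩ := h
  refine ⟨h0.trans hD, Φ, ψ, h1, h2, h3, h4, h5, fun f g Gf Gg hf hg n => ?_⟩
  refine (h6 f g Gf Gg hf hg n).trans ?_
  have hf0 : 0 ≤ hDot1Norm U κ Gf := Real.sqrt_nonneg _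
  have hg0 : 0 ≤ hDot1Norm U κ Gg := Real.sqrt_nonneg _
  beta_reduce
  gcongr

theorem isMixingConstant_of_jacobianBound {A : Matrix.SpecialLinearGroup (Fin d) ℤ} {c r : ℝ}
    (hA : Expands c r A.1.transpose) (hc : 0 < c) (hr : 0 < r) (hU : Continuous U)
    (hψ : IsDiffeo 2 ψ) (hm : MeasurePreserving ψ (gibbs U κ) (leb d)) (hF : ContDiff ℝ 1 F)
    (hψF : ∀ y, ψ.symm (proj d y) = proj d (F y)) (hL : JacobianBound L F) (hL0 : 0 ≤ L) :
    IsMixingConstant (Real.log r / 2) A U κ (L / (4 * Real.pi ^ 2 * Real.sqrt c)) := by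
  have hmsymm := hψ.measurePreserving_symm hm
  exact ⟨by positivity, (ψ.trans (toralEquiv A)).trans ψ.symm, ψ,
    (hψ.trans (isDiffeo_toralEquiv A)).trans hψ.symm, hψ, hm, fun x => rfl,
    hmsymm.comp ((measurePreserving_toralEquiv A).comp hm),
    mixesWithRate_conj hA hc hr hU hψ hm hF hψF hL hL0 fun x => rfl⟩

theorem exists_isMixingConstant {A : Matrix.SpecialLinearGroup (Fin d) ℤ} {c r : ℝ}
    (hA : Expands c r A.1.transpose) (hc : 0 < c) (hr : 0 < r) (hU : FunContDiff 2 U) (κ : ℝ) :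
    ∃ D, IsMixingConstant (Real.log r / 2) A U κ D := by
  obtain ⟨ψ, hψ, hm⟩ := exists_isDiffeo_measurePreserving_gibbs hU κ
  obtain ⟨F, hF, hψF⟩ := hψ.2
  have hF1 : ContDiff ℝ 1 F := hF.of_le (by norm_num)
  obtain ⟨L, hL0, hL⟩ := exists_jacobianBound hF1
  exact ⟨_, isMixingConstant_of_jacobianBound hA hc hr hU.continuous hψ hm hF1 hψF hL hL0⟩

theorem isMixingConstant_separable {A : Matrix.SpecialLinearGroup (Fin d) ℤ} {c r : ℝ}
    (hA : Expands c r A.1.transpose) (hc : 0 < c) (hr : 0 < r) {V : UnitAddCircle → ℝ}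
    (hV : ContDiff ℝ 2 fun t : ℝ => V t) {M : ℝ} (hM : ∀ t, |V t| ≤ M) (hκ : 0 < κ) :
    IsMixingConstant (Real.log r / 2) A (separable d V) κ
      (Real.exp (2 * M / κ) ^ 2 / (4 * Real.pi ^ 2 * Real.sqrt c)) := by
  have hVc : Continuous V := (QuotientAddGroup.isQuotientMap_mk _).continuous_iff.2 hV.continuous
  obtain ⟨ψ, hψ, hm, g, hg, hg', hψF⟩ :=
    exists_isDiffeo_measurePreserving_gibbs_separable d hV hM hκ
  have hg1 : ContDiff ℝ 1 g := hg.of_le (by norm_num)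
  exact isMixingConstant_of_jacobianBound hA hc hr (by unfold separable; fun_prop) hψ hm
    (contDiff_pi.2 fun i => hg1.comp (contDiff_apply ℝ ℝ i)) hψF
    (jacobianBound_diagonal hg1 hg') (sq_nonneg _)

end Limit

end TorusMixing

end

theorem proposition5p1 :
    ∃ (γ : ℝ) (A : ∀ d : ℕ, Matrix.SpecialLinearGroup (Fin d) ℤ)
      (D : ∀ d : ℕ, (TorusMixing.T d → ℝ) → ℝ → ℝ),
      0 < γ ∧
      (∀ d : ℕ, 2 ≤ d →
        TorusMixing.IsHyperbolic (A d).1 ∧ TorusMixing.IsBlockDiagonalTwoThree (A d).1) ∧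
      (∀ (d : ℕ) (U : TorusMixing.T d → ℝ) (κ : ℝ),
        2 ≤ d → TorusMixing.FunContDiff 2 U → 0 < κ →
          0 < D d U κ ∧
          ∃ Φ ψ : TorusMixing.T d ≃ TorusMixing.T d,
            TorusMixing.IsDiffeo 2 Φ ∧ TorusMixing.IsDiffeo 2 ψ ∧
            MeasurePreserving ψ (TorusMixing.gibbs U κ) (TorusMixing.leb d) ∧
            (∀ x, Φ x = ψ.symm (TorusMixing.toralMap (A d).1 (ψ x))) ∧
            MeasurePreserving Φ (TorusMixing.gibbs U κ) (TorusMixing.gibbs U κ) ∧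
            TorusMixing.MixesWithRate U κ Φ (fun n => D d U κ * Real.exp (-γ * n))) ∧
      (∀ V : UnitAddCircle → ℝ, ContDiff ℝ 2 (fun t : ℝ => V (t : UnitAddCircle)) →
        ∃ C κ₀ : ℝ, 0 < κ₀ ∧ ∀ (d : ℕ) (κ : ℝ), 2 ≤ d → 0 < κ → κ < κ₀ →
          D d (TorusMixing.separable d V) κ ≤ Real.sqrt d * Real.exp (C / κ)) := by
  obtain ⟨c, hc, hA⟩ := TorusMixing.exists_hyperbolic_matrix
  choose! A hyp hblock hexp using hA
  have hr : (0 : ℝ) < 13 / 10 := by norm_num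
  set γ := Real.log (13 / 10) / 2
  have hbdd : ∀ d (U : TorusMixing.T d → ℝ) κ,
      BddBelow {D | TorusMixing.IsMixingConstant γ (A d) U κ D} := fun d U κ =>
    ⟨0, fun D hD => hD.1⟩
  -- The infimum need not be admissible; adding one makes the constant admissible and positive.
  refine ⟨γ, A, fun d U κ => 1 + sInf {D | TorusMixing.IsMixingConstant γ (A d) U κ D},
    by have := Real.log_pos (x := 13 / 10) (by norm_num); positivity,
    fun d hd => ⟨hyp d hd, hblock d hd⟩, ?_, ?_⟩
  · intro d U κ hd hU _
    have h0 : 0 ≤ sInf {D | TorusMixing.IsMixingConstant γ (A d) U κ D} :=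
      Real.sInf_nonneg fun D hD => hD.1
    obtain ⟨D, hD, hlt⟩ := exists_lt_of_csInf_lt
      (TorusMixing.exists_isMixingConstant (hexp d hd) hc hr hU κ)
      (lt_one_add (sInf {D | TorusMixing.IsMixingConstant γ (A d) U κ D}))
    exact ⟨by linarith, (TorusMixing.IsMixingConstant.mono hD hlt.le).2⟩
  · intro V hV
    have hVc : Continuous V := (QuotientAddGroup.isQuotientMap_mk _).continuous_iff.2 hV.continuous
    obtain ⟨M, hM⟩ := isCompact_univ.exists_bound_of_continuousOn hVc.continuousOn
    have hM' : ∀ t, |V t| ≤ M := fun t => hM t trivial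
    have hM0 : 0 ≤ M := (abs_nonneg _).trans (hM' 0)
    set K := (4 * Real.pi ^ 2 * Real.sqrt c)⁻¹
    have hK : 0 ≤ K := by positivity
    refine ⟨4 * M + Real.log (1 + K), 1, one_pos, fun d κ hd hκ hκ1 => ?_⟩
    have hmem := TorusMixing.isMixingConstant_separable (hexp d hd) hc hr hV hM' hκ
    have hE : Real.exp (2 * M / κ) ^ 2 = Real.exp (4 * M / κ) := by
      rw [← Real.exp_nat_mul]; congr 1; push_cast; ring
    rw [hE] at hmem
    have hle := (csInf_le (hbdd d _ κ) hmem).trans_eq (div_eq_mul_inv _ _)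
    have h1 : 1 ≤ Real.exp (4 * M / κ) := Real.one_le_exp (by positivity)
    have hlog : 0 ≤ Real.log (1 + K) := Real.log_nonneg (by linarith)
    have hd1 : 1 ≤ Real.sqrt d := Real.one_le_sqrt.2 (by exact_mod_cast (by omega : 1 ≤ d))
    calc 1 + sInf {D | TorusMixing.IsMixingConstant γ (A d) (TorusMixing.separable d V) κ D}
        ≤ Real.exp (4 * M / κ) * (1 + K) := by linarith
      _ = Real.exp (4 * M / κ + Real.log (1 + K)) := by
          rw [Real.exp_add, Real.exp_log (by linarith)]
      _ ≤ Real.exp ((4 * M + Real.log (1 + K)) / κ) := by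
          rw [add_div]
          have : Real.log (1 + K) ≤ Real.log (1 + K) / κ :=
            le_div_self hlog hκ hκ1.le
          gcongr
      _ ≤ Real.sqrt d * Real.exp ((4 * M + Real.log (1 + K)) / κ) :=
          le_mul_of_one_le_left (Real.exp_pos _).le hd1
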